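/- **Theorem 1 (Minimax lower bound on estimating the moment under covariate shift).** Let $d\ge 1$, $s\ge 0$ and $q$ be integers and let $p$ be a real number with $p\ge 2$ and $q\le p\le 2q$. Let $\Omega=[0,1]^d$, and let $\mathcal W^{s,p}(\Omega)$ be the space of all $f\in L^p(\Omega)$ whose weak derivatives $D^\alpha f$, $|\alpha|\le s$, lie in $L^p(\Omega)$, with norm $\|f\|_{\mathcal W^{s,p}}=\big(\sum_{|\alpha|\le s}\|D^\alpha f\|_{L^p(\Omega)}^p\big)^{1/p}$. For $0<\underline b\le\bar b$ and $B\ge 1$ let $\mathcal V=\mathcal V(\underline b,\bar b,B,s,p)$ be the set of all triples $(f,p^\circ,p^*)$ such that $f\in\mathcal W^{s,p}(\Omega)$ and $p^\circ,p^*$ are probability densities on $\Omega$ with $\underline b\le p^\circ\le\bar b$ and $\sup_{x\in\Omega}p^*(x)/p^\circ(x)\le B$. For a density $p^*$ put $\mathcal V_{p^*}=\{(f,p^\circ):(f,p^\circ,p^*)\in\mathcal V\}$ and, for $L>0$, $\mathcal V_{p^*}(L)=\{(f,p^\circ)\in\mathcal V_{p^*}:\|f\|_{\mathcal W^{s,p}}\le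 L\}$. Let $I_f^q=\int_\Omega f(x)^q\,p^*(x)\,dx$ be the $q$-th moment of $f$ under the target. An estimator is a measurable map $\hat H:\Omega^n\times\mathbb R^n\to\mathbb R$; it is applied to the sample $\mathcal S=\{(x_i,y_i)\}_{i=1}^n$, where $x_1,\dots,x_n$ are i.i.d. with density $p^\circ$ and $y_i=f(x_i)$. (a) There is a constant $c>0$ that depends only on $d,s,p,q$ such that for all $0<\underline b\le\bar b$ and $B\ge1$, every target density $p^*$ with $\mathcal V_{p^*}\ne\emptyset$ and every $n\ge 1$, $$\inf_{\hat H}\ \sup_{(f,p^\circ)\in\mathcal V_{p^*}}\mathbb E_{\mathcal S}\big|\hat H(\mathcal S)-I_f^q\big|\ \ge\ c\,B\,\bar b\,n^{\max\{-q(\frac sd-\frac1p)-1,\,-\frac12-\frac sd\}} .$$ (b) The same rate holds on every Sobolev ball: for all $0<\underline b\le\bar b$, $B\ge 1$ and $L>0$ there is a constant $c>0$, depending only on $d,s,p,q,\underline b,\bar b,B,L$, such that for every target density $p^*$ with $\mathcal V_{p^*}\ne\emptyset$ and every $n\ge1$, $$\inf_{\hat H}\ \sup_{(f,p^\circ)\in\mathcal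 V_{p^*}(L)}\mathbb E_{\mathcal S}\big|\hat H(\mathcal S)-I_f^q\big|\ \ge\ c\,B\,\bar b\,n^{\max\{-q(\frac sd-\frac1p)-1,\,-\frac12-\frac sd\}} .$$ -/

import Mathlib

open MeasureTheory
open scoped ENNReal ContDiff

noncomputable section

namespace CovShift

/-- The unit cube `Ω = [0,1]^d`. -/
def cube (d : ℕ) : Set (Fin d → ℝ) := Set.Icc 0 1

/-- Lebesgue measure on the unit cube. -/
def cubeVolume (d : ℕ) : Measure (Fin d → ℝ) := volume.restrict (cube d)

/-- The classical partial derivative `∂φ/∂x_i`. -/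
def partialDeriv {d : ℕ} (i : Fin d) (φ : (Fin d → ℝ) → ℝ) : (Fin d → ℝ) → ℝ :=
  fun x => fderiv ℝ φ x (Pi.single i 1)

/-- The classical derivative `D^α φ = ∂_1^{α_1} ⋯ ∂_d^{α_d} φ` for a multi-index `α`. -/
def multiDeriv {d : ℕ} (α : Fin d → ℕ) (φ : (Fin d → ℝ) → ℝ) : (Fin d → ℝ) → ℝ :=
  (List.finRange d).foldr (fun i g => (partialDeriv i)^[α i] g) φ

/-- `g` is the weak derivative `D^α f` on (the interior of) the unit cube, tested against
smooth functions whose compact support lies in the open cube. It is only used for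
`f, g ∈ L^p`, so that both integrals exist. -/
def HasWeakDeriv {d : ℕ} (α : Fin d → ℕ) (f g : (Fin d → ℝ) → ℝ) : Prop :=
  ∀ φ : (Fin d → ℝ) → ℝ, ContDiff ℝ ∞ φ → HasCompactSupport φ →
    tsupport φ ⊆ interior (cube d) →
      ∫ x, f x * multiDeriv α φ x ∂(cubeVolume d)
        = (-1 : ℝ) ^ (∑ i, α i) * ∫ x, g x * φ x ∂(cubeVolume d)

/-- The multi-indices `α` with `|α| ≤ s`. -/
def multiIndices (d s : ℕ) : Finset (Fin d → ℕ) :=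
  (Fintype.piFinset fun _ => Finset.range (s + 1)).filter fun α => ∑ i, α i ≤ s

/-- `f ∈ W^{s,p}(Ω)`: `f` and all its weak derivatives of order at most `s` lie in `L^p(Ω)`. -/
def MemSobolev (d s : ℕ) (p : ℝ) (f : (Fin d → ℝ) → ℝ) : Prop :=
  MemLp f (ENNReal.ofReal p) (cubeVolume d) ∧
    ∀ α ∈ multiIndices d s, ∃ g : (Fin d → ℝ) → ℝ,
      MemLp g (ENNReal.ofReal p) (cubeVolume d) ∧ HasWeakDeriv α f g

/-- `‖D^α f‖_{L^p(Ω)}`. The weak derivative is unique up to null sets, so the infimum is over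
a single value (and it is `∞` if there is no weak derivative in `L^p`). -/
def weakDerivNorm {d : ℕ} (p : ℝ) (α : Fin d → ℕ) (f : (Fin d → ℝ) → ℝ) : ℝ≥0∞ :=
  ⨅ (g : (Fin d → ℝ) → ℝ) (_ : MemLp g (ENNReal.ofReal p) (cubeVolume d))
    (_ : HasWeakDeriv α f g), eLpNorm g (ENNReal.ofReal p) (cubeVolume d)

/-- The Sobolev norm `(∑_{|α| ≤ s} ‖D^α f‖_{L^p(Ω)}^p)^{1/p}`. -/
def sobolevNorm (d s : ℕ) (p : ℝ) (f : (Fin d → ℝ) → ℝ) : ℝ≥0∞ :=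
  (∑ α ∈ multiIndices d s, weakDerivNorm p α f ^ p) ^ (1 / p)

/-- `ρ` is a probability density function on the unit cube. Its values outside the cube play
no role. -/
structure IsDensity (d : ℕ) (ρ : (Fin d → ℝ) → ℝ) : Prop where
  measurable : Measurable ρ
  nonneg : ∀ x ∈ cube d, 0 ≤ ρ x
  lintegral_eq_one : ∫⁻ x, ENNReal.ofReal (ρ x) ∂(cubeVolume d) = 1

/-- The distribution on the unit cube with density `ρ`. -/
def densityMeasure (d : ℕ) (ρ : (Fin d → ℝ) → ℝ) : Measure (Fin d → ℝ) :=
  (cubeVolume d).withDensity fun x => ENNReal.ofReal (ρ x)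

/-- The class `𝒱` of triples `(f, p°, p*)`: `f ∈ W^{s,p}(Ω)`, the densities `p°` (source) and
`p*` (target) satisfy `bl ≤ p° ≤ bu` and `p* / p° ≤ B` on the cube. -/
def shiftClass (d s : ℕ) (p bl bu B : ℝ) :
    Set (((Fin d → ℝ) → ℝ) × ((Fin d → ℝ) → ℝ) × ((Fin d → ℝ) → ℝ)) :=
  {v | MemSobolev d s p v.1 ∧ IsDensity d v.2.1 ∧ IsDensity d v.2.2 ∧
    (∀ x ∈ cube d, bl ≤ v.2.1 x ∧ v.2.1 x ≤ bu) ∧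
    ∀ x ∈ cube d, v.2.2 x / v.2.1 x ≤ B}

/-- The section `𝒱_{p*}` of the class `𝒱` at a target density `pt`: the pairs `(f, p°)` with
`(f, p°, pt) ∈ 𝒱`. -/
def shiftClassAt (d s : ℕ) (p bl bu B : ℝ) (pt : (Fin d → ℝ) → ℝ) :
    Set (((Fin d → ℝ) → ℝ) × ((Fin d → ℝ) → ℝ)) :=
  {v | (v.1, v.2, pt) ∈ shiftClass d s p bl bu B}

/-- The pairs `(f, p°)` in `𝒱_{p*}` with `‖f‖_{W^{s,p}(Ω)} ≤ L`. -/
def shiftClassBallAt (d s : ℕ) (p bl bu B L : ℝ) (pt : (Fin d → ℝ) → ℝ) :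
    Set (((Fin d → ℝ) → ℝ) × ((Fin d → ℝ) → ℝ)) :=
  {v | v ∈ shiftClassAt d s p bl bu B pt ∧ sobolevNorm d s p v.1 ≤ ENNReal.ofReal L}

/-- The target moment `I_f^q = E_{X ∼ P*} [f(X)^q]`. -/
def moment (d q : ℕ) (pt f : (Fin d → ℝ) → ℝ) : ℝ :=
  ∫ x, f x ^ q ∂(densityMeasure d pt)

/-- The expected absolute error of the estimator `H`, for `n` i.i.d. design points `x_i` with
density `ps` and noiseless observations `y_i = f(x_i)`. -/
def risk (d q n : ℕ) (pt : (Fin d → ℝ) → ℝ)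
    (H : (Fin n → Fin d → ℝ) × (Fin n → ℝ) → ℝ) (f ps : (Fin d → ℝ) → ℝ) : ℝ≥0∞ :=
  ∫⁻ x, ENNReal.ofReal |H (x, fun i => f (x i)) - moment d q pt f|
    ∂(Measure.pi fun _ : Fin n => densityMeasure d ps)

/-- The minimax risk over a class `C` of pairs `(f, p°)`, the infimum being over all
(measurable) estimators. -/
def minimaxRisk (d q n : ℕ) (pt : (Fin d → ℝ) → ℝ)
    (C : Set (((Fin d → ℝ) → ℝ) × ((Fin d → ℝ) → ℝ))) : ℝ≥0∞ :=
  ⨅ (H : (Fin n → Fin d → ℝ) × (Fin n → ℝ) → ℝ) (_ : Measurable H),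
    ⨆ v ∈ C, risk d q n pt H v.1 v.2

/-- The exponent `max {-q (s/d - 1/p) - 1, -1/2 - s/d}`. -/
def rateExponent (d s q : ℕ) (p : ℝ) : ℝ :=
  max (-(q : ℝ) * ((s : ℝ) / d - 1 / p) - 1) (-(1 / 2) - (s : ℝ) / d)

end CovShift

end

namespace CovShift

/-! Noiseless data reveal nothing about `f` where no design point falls. Fix the source density of a
given triple and a grid of `m ^ d` cells, with `m ^ d` of order `n`, so fine that each cell has
source mass at most `1 / (2n)`; each cell is then missed by the sample with probability at least `1
/ 2`. Put smooth bumps on a random set `T` of cells, over a constant `M`. Flipping `T` on the missed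
cells `U` leaves the data unchanged, so any estimator must absorb the difference of the two moments.
By disjointness of supports the moment is additive in `T`; that difference is a Rademacher sum over
`U`, which Khintchine bounds below (`sum_abs_sub_ge`, `average_error_ge`, `minimaxRisk_ge`).

The target density is bounded above by `B * bu` but may vanish on many cells. Bumps equal to `1`
except on a tiny fraction of each cell still see half of the target mass in total
(`half_le_sum_core`), and only this total is needed.

On a ball, the first rate comes from one tall bump over `M = 0` on a cell with much target mass,
where the moment moves by `A ^ q`. The second comes from bumps on all cells over a positive constant
`M`: the moment now moves linearly in `A`, and the fluctuations of `m ^ d` independent signs add up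
in the square-root sense. `exists_sobolev_bound` fixes the admissible amplitudes. Without a norm
bound the amplitude is free and the risk is infinite, so (a) holds with any constant. -/

/-- The sign of `k` in the configuration encoded by the set `T` of positive indices. -/
def sign {ι : Type*} [DecidableEq ι] (T : Finset ι) (k : ι) : ℝ := if k ∈ T then 1 else -1

/-! ### Moments of Rademacher sums and the `L¹` Khintchine inequality. -/

section Khintchine

variable {ι : Type*} [DecidableEq ι]

theorem sum_sign_mul_of_notMem {S T : Finset ι} {a : ι} (haS : a ∉ S) (hT : T ⊆ S) (w : ι → ℝ) :
    ∑ k ∈ insert a S, sign T k * w k = ∑ k ∈ S, sign T k * w k - w a := by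
  have : a ∉ T := fun h => haS (hT h)
  rw [Finset.sum_insert haS]
  simp [sign, this]
  ring

theorem sum_sign_insert_mul {S T : Finset ι} {a : ι} (haS : a ∉ S) (w : ι → ℝ) :
    ∑ k ∈ insert a S, sign (insert a T) k * w k = ∑ k ∈ S, sign T k * w k + w a := by
  rw [Finset.sum_insert haS]
  have : ∀ k ∈ S, sign (insert a T) k * w k = sign T k * w k := by
    intro k hk
    have : k ≠ a := fun h => haS (h ▸ hk)
    simp [sign, this]
  rw [Finset.sum_congr rfl this]
  simp [sign]
  ring

/-- Conditioning on the sign of `a`: the induction step for both the second and the fourth moment.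
-/
theorem sum_powerset_insert_sign (F : ℝ → ℝ) {S : Finset ι} {a : ι} (haS : a ∉ S) (w : ι → ℝ) :
    ∑ T ∈ (insert a S).powerset, F (∑ k ∈ insert a S, sign T k * w k) =
      ∑ T ∈ S.powerset,
        (F (∑ k ∈ S, sign T k * w k - w a) + F (∑ k ∈ S, sign T k * w k + w a)) := by
  rw [Finset.sum_powerset_insert haS, ← Finset.sum_add_distrib]
  refine Finset.sum_congr rfl fun T hT => ?_
  rw [sum_sign_mul_of_notMem haS (Finset.mem_powerset.1 hT), sum_sign_insert_mul haS]

/-- The second moment of a Rademacher sum. -/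
theorem sum_powerset_sq (S : Finset ι) (w : ι → ℝ) :
    ∑ T ∈ S.powerset, (∑ k ∈ S, sign T k * w k) ^ 2 = 2 ^ S.card * ∑ k ∈ S, w k ^ 2 := by
  induction S using Finset.induction_on with
  | empty => simp
  | insert a S haS ih =>
    rw [sum_powerset_insert_sign (fun x => x ^ 2) haS, Finset.card_insert_of_notMem haS,
      Finset.sum_insert haS]
    have : ∀ x : ℝ, (x - w a) ^ 2 + (x + w a) ^ 2 = 2 * x ^ 2 + 2 * w a ^ 2 := fun x => by ring
    simp only [this, Finset.sum_add_distrib, ← Finset.mul_sum, ih, Finset.sum_const,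
      Finset.card_powerset, nsmul_eq_mul]
    push_cast
    ring

/-- The fourth moment of a Rademacher sum. -/
theorem sum_powerset_pow_four_le (S : Finset ι) (w : ι → ℝ) :
    ∑ T ∈ S.powerset, (∑ k ∈ S, sign T k * w k) ^ 4 ≤
      3 * 2 ^ S.card * (∑ k ∈ S, w k ^ 2) ^ 2 := by
  induction S using Finset.induction_on with
  | empty => simp
  | insert a S haS ih =>
    rw [sum_powerset_insert_sign (fun x => x ^ 4) haS, Finset.card_insert_of_notMem haS,
      Finset.sum_insert haS]
    have : ∀ x : ℝ, (x - w a) ^ 4 + (x + w a) ^ 4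
      = 2 * x ^ 4 + 12 * w a ^ 2 * x ^ 2 + 2 * w a ^ 4 := fun x => by ring
    simp only [this, Finset.sum_add_distrib, ← Finset.mul_sum, sum_powerset_sq, Finset.sum_const,
      Finset.card_powerset, nsmul_eq_mul]
    push_cast
    have h4 : (0 : ℝ) ≤ 2 ^ S.card * w a ^ 4 := by positivity
    rw [pow_succ 2 S.card]
    linear_combination 2 * ih + 4 * h4

/-- The `L¹` Khintchine inequality. -/
theorem khintchine (S : Finset ι) (w : ι → ℝ) :
    2 ^ S.card * (√(∑ k ∈ S, w k ^ 2) / 2) ≤ ∑ T ∈ S.powerset, |∑ k ∈ S, sign T k * w k| := by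
  set V := ∑ k ∈ S, w k ^ 2 with hV
  have hV0 : 0 ≤ V := Finset.sum_nonneg fun _ _ => sq_nonneg _
  rcases hV0.eq_or_lt with h0 | hpos
  · rw [← h0]
    simp only [Real.sqrt_zero, zero_div, mul_zero]
    exact Finset.sum_nonneg fun _ _ => abs_nonneg _
  set r := √V with hr
  have hr0 : 0 < r := Real.sqrt_pos.2 hpos
  have hrV : V = r ^ 2 := (Real.sq_sqrt hV0).symm
  -- A quartic minorant of `|x|`, touching it at `0` and at `±2r`. It needs only the second and
  -- fourth moments, and its mean is at least `(3/4 - 3/16) r = 9/16 r`, above the claimed `r / 2`.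
  have key : ∀ x : ℝ, 3 / (4 * r) * x ^ 2 - 1 / (16 * r ^ 3) * x ^ 4 ≤ |x| := by
    intro x
    have h1 : x ^ 2 = |x| ^ 2 := (sq_abs x).symm
    have h2 : x ^ 4 = |x| ^ 4 := by rw [show 4 = 2 * 2 by rfl, pow_mul, pow_mul, sq_abs]
    rw [h1, h2]
    have hy := abs_nonneg x
    set y := |x|
    have : y - (3 / (4 * r) * y ^ 2 - 1 / (16 * r ^ 3) * y ^ 4)
        = y * (y - 2 * r) ^ 2 * (y + 4 * r) / (16 * r ^ 3) := by
      field_simp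
      ring
    have h3 : 0 ≤ y * (y - 2 * r) ^ 2 * (y + 4 * r) / (16 * r ^ 3) := by positivity
    linarith
  have h4 := sum_powerset_pow_four_le S w
  calc 2 ^ S.card * (r / 2)
      ≤ 3 / (4 * r) * (2 ^ S.card * V) - 1 / (16 * r ^ 3) * (3 * 2 ^ S.card * V ^ 2) := by
        rw [hrV]
        have : 3 / (4 * r) * (2 ^ S.card * r ^ 2)
            - 1 / (16 * r ^ 3) * (3 * 2 ^ S.card * (r ^ 2) ^ 2)
          = 2 ^ S.card * (9 / 16 * r) := by field_simp; ring
        rw [this]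
        gcongr ?_ * ?_
        linarith
    _ ≤ 3 / (4 * r) * (∑ T ∈ S.powerset, (∑ k ∈ S, sign T k * w k) ^ 2)
          - 1 / (16 * r ^ 3) * ∑ T ∈ S.powerset, (∑ k ∈ S, sign T k * w k) ^ 4 := by
        rw [sum_powerset_sq]
        gcongr
    _ = ∑ T ∈ S.powerset, (3 / (4 * r) * (∑ k ∈ S, sign T k * w k) ^ 2
          - 1 / (16 * r ^ 3) * (∑ k ∈ S, sign T k * w k) ^ 4) := by
        rw [Finset.sum_sub_distrib, Finset.mul_sum, Finset.mul_sum]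
    _ ≤ _ := Finset.sum_le_sum fun T _ => key _

/-- Cauchy–Schwarz trades the `ℓ²` norm for the total weight. Only the total is controlled later,
since the target mass may be spread unevenly over the cells. -/
theorem sum_div_sqrt_card_le [Fintype ι] (w : ι → ℝ) :
    2 ^ Fintype.card ι * ((∑ k, w k) / (2 * √(Fintype.card ι))) ≤
      ∑ T : Finset ι, |∑ k, sign T k * w k| := by
  have h := khintchine Finset.univ w
  rw [Finset.powerset_univ, Finset.card_univ] at h
  refine le_trans ?_ h
  gcongr ?_ * ?_
  have hcs := sq_sum_le_card_mul_sum_sq (s := Finset.univ) (f := w)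
  rw [Finset.card_univ] at hcs
  have h1 : ∑ k, w k ≤ √(Fintype.card ι) * √(∑ k, w k ^ 2) := by
    rw [← Real.sqrt_mul (by positivity)]
    exact Real.le_sqrt_of_sq_le hcs
  rcases Nat.eq_zero_or_pos (Fintype.card ι) with h0 | h0
  · rw [h0]; simp; positivity
  have : 0 < √(Fintype.card ι : ℝ) := Real.sqrt_pos.2 (by exact_mod_cast h0)
  rw [div_le_div_iff₀ (by positivity) (by positivity)]
  nlinarith

end Khintchine

/-! ### Bayes risk under a uniform prior on configurations. -/

section Bayes

variable {ι : Type*} [DecidableEq ι] [Fintype ι]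

/-- If the statistic `h` does not change when the configuration is flipped on `U`, its total
absolute error as an estimator of a linear functional is at least that of a Rademacher sum. -/
theorem sum_abs_sub_ge (U : Finset ι) (w : ι → ℝ) (I₀ : ℝ) (h : Finset ι → ℝ)
    (hh : ∀ T, h (symmDiff T U) = h T) :
    2 ^ Fintype.card ι * ((∑ k ∈ U, w k) / (4 * √(Fintype.card ι))) ≤
      ∑ T : Finset ι, |h T - (I₀ + ∑ k ∈ T, w k)| := by
  -- Flipping on `U` is an involution of the configurations that preserves `h`, so the total error
  -- is the same with the flipped functional. The triangle inequality then compares the two.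
  have hinv : ∑ T : Finset ι, |h T - (I₀ + ∑ k ∈ T, w k)|
      = ∑ T : Finset ι, |h T - (I₀ + ∑ k ∈ symmDiff T U, w k)| := by
    rw [← Equiv.sum_comp (Function.Involutive.toPerm (fun T : Finset ι => symmDiff T U)
      (fun T => symmDiff_symmDiff_cancel_right U T))]
    refine Finset.sum_congr rfl fun T _ => ?_
    simp [Function.Involutive.toPerm, hh]
  have hdiff : ∀ T : Finset ι, ∑ k ∈ T, w k - ∑ k ∈ symmDiff T U, w k
      = ∑ k, sign T k * (if k ∈ U then w k else 0) := by
    intro T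
    have hite : ∀ A : Finset ι, ∑ k ∈ A, w k = ∑ k, if k ∈ A then w k else 0 := fun A => by
      simp [Finset.sum_ite_mem]
    rw [hite T, hite (symmDiff T U), ← Finset.sum_sub_distrib]
    refine Finset.sum_congr rfl fun k _ => ?_
    by_cases h1 : k ∈ T <;> by_cases h2 : k ∈ U <;> simp [sign, Finset.mem_symmDiff, h1, h2]
  have hkh := sum_div_sqrt_card_le (fun k => if k ∈ U then w k else 0)
  have h2 : ∑ T : Finset ι, |∑ k, sign T k * (if k ∈ U then w k else 0)|
      ≤ ∑ T : Finset ι, (|h T - (I₀ + ∑ k ∈ T, w k)| + |h T - (I₀ + ∑ k ∈ symmDiff T U, w k)|) := by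
    refine Finset.sum_le_sum fun T _ => ?_
    rw [← hdiff, ← add_sub_add_left_eq_sub _ _ I₀, abs_sub_comm (h T) (I₀ + ∑ k ∈ T, w k)]
    exact abs_sub_le _ (h T) _
  rw [Finset.sum_add_distrib, ← hinv] at h2
  have h3 := hkh.trans h2
  have h4 : ∑ k, (if k ∈ U then w k else 0) = ∑ k ∈ U, w k := by
    simp [Finset.sum_ite_mem]
  rw [h4] at h3
  have h5 : (∑ k ∈ U, w k) / (2 * √(Fintype.card ι))
      = 2 * ((∑ k ∈ U, w k) / (4 * √(Fintype.card ι))) := by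
    field_simp; norm_num
  rw [h5] at h3
  linarith

variable {X : Type*} [MeasurableSpace X]

/-- Independence and Bernoulli's inequality: `(1 - 1/(2n))^n ≥ 1/2`. -/
theorem half_le_pi_forall_notMem (ν : Measure X) [IsProbabilityMeasure ν] {n : ℕ} (hn : 0 < n)
    {E : Set X} (hE : MeasurableSet E) (hνE : ν E ≤ ENNReal.ofReal (1 / (2 * n))) :
    ENNReal.ofReal (1 / 2) ≤ Measure.pi (fun _ : Fin n => ν) {x | ∀ i, x i ∉ E} := by
  have hset : {x : Fin n → X | ∀ i, x i ∉ E} = Set.pi Set.univ fun _ => Eᶜ := by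
    ext x; simp
  rw [hset, Measure.pi_pi, Finset.prod_const, Finset.card_univ, Fintype.card_fin]
  have hn' : (1 : ℝ) ≤ n := by exact_mod_cast hn
  have h1 : ENNReal.ofReal (1 - 1 / (2 * n)) ≤ ν Eᶜ := by
    rw [prob_compl_eq_one_sub hE, ENNReal.ofReal_sub _ (by positivity), ENNReal.ofReal_one]
    exact tsub_le_tsub_left hνE 1
  have h2 : (1 : ℝ) / (2 * n) ≤ 1 / 2 := by
    apply one_div_le_one_div_of_le <;> linarith
  calc ENNReal.ofReal (1 / 2) ≤ ENNReal.ofReal ((1 - 1 / (2 * n)) ^ n) := by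
        apply ENNReal.ofReal_le_ofReal
        have := one_add_mul_le_pow (a := -(1 / (2 * n) : ℝ)) (by linarith) n
        have h3 : (1 : ℝ) + n * -(1 / (2 * n)) = 1 / 2 := by field_simp; ring
        rw [h3] at this
        simpa [sub_eq_add_neg] using this
    _ = ENNReal.ofReal (1 - 1 / (2 * n)) ^ n := ENNReal.ofReal_pow (by linarith) n
    _ ≤ _ := by gcongr

/-- Average-case lower bound: when the `n`-point sample misses each cell `E k` with probability at
least `1 / 2` and `f T` depends on `k ∈ T` only inside `E k`, a functional of `f T` that is additive
in `T` cannot be estimated with error below the order of its Rademacher fluctuation. -/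
theorem average_error_ge (ν : Measure X) [IsProbabilityMeasure ν] {n : ℕ} (hn : 0 < n)
    (E : ι → Set X) (hE : ∀ k, MeasurableSet (E k))
    (hνE : ∀ k, ν (E k) ≤ ENNReal.ofReal (1 / (2 * n)))
    (f : Finset ι → X → ℝ) (hf : ∀ T, Measurable (f T))
    (hloc : ∀ T T' x, (∀ k, x ∈ E k → (k ∈ T ↔ k ∈ T')) → f T x = f T' x)
    (w : ι → ℝ) (hw : ∀ k, 0 ≤ w k) (I₀ : ℝ)
    (H : (Fin n → X) × (Fin n → ℝ) → ℝ) (hH : Measurable H) :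
    2 ^ Fintype.card ι * ENNReal.ofReal ((∑ k, w k) / (8 * √(Fintype.card ι))) ≤
      ∑ T : Finset ι, ∫⁻ x, ENNReal.ofReal |H (x, fun i => f T (x i)) - (I₀ + ∑ k ∈ T, w k)|
        ∂(Measure.pi fun _ : Fin n => ν) := by
  classical
  have hmeas : ∀ T : Finset ι, Measurable fun x : Fin n → X =>
      ENNReal.ofReal |H (x, fun i => f T (x i)) - (I₀ + ∑ k ∈ T, w k)| := by
    intro T
    have h1 : Measurable fun x : Fin n → X => H (x, fun i => f T (x i)) :=
      hH.comp (measurable_id.prodMk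
        (measurable_pi_lambda _ fun i => (hf T).comp (measurable_pi_apply i)))
    exact ((h1.sub_const _).abs).ennreal_ofReal
  rw [← lintegral_finsetSum _ fun T _ => hmeas T]
  set a : ℝ := 1 / (4 * √(Fintype.card ι)) with ha
  have ha0 : 0 ≤ a := by positivity
  have hG : ∀ k, MeasurableSet {x : Fin n → X | ∀ i, x i ∉ E k} := by
    intro k
    rw [Set.ofPred_forall]
    exact MeasurableSet.iInter fun i => (measurable_pi_apply i (hE k)).compl
  have hpt : ∀ x : Fin n → X,
      2 ^ Fintype.card ι * ∑ k, Set.indicator {x : Fin n → X | ∀ i, x i ∉ E k}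
        (fun _ => ENNReal.ofReal (a * w k)) x
      ≤ ∑ T : Finset ι, ENNReal.ofReal |H (x, fun i => f T (x i)) - (I₀ + ∑ k ∈ T, w k)| := by
    intro x
    -- The cells that contain no design point. By locality the observations, and hence the estimate,
    -- ignore `T` on `U`. Integrating over `x` afterwards gives each cell its probability of lying
    -- in `U`.
    set U : Finset ι := Finset.univ.filter fun k => ∀ i, x i ∉ E k with hU
    have h1 := sum_abs_sub_ge U w I₀ (fun T => H (x, fun i => f T (x i))) (by
      intro T
      have : (fun i => f (symmDiff T U) (x i)) = fun i => f T (x i) := by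
        funext i
        refine hloc _ _ _ fun k hk => ?_
        have : k ∉ U := by
          simp only [hU, Finset.mem_filter, not_and, not_forall, not_not]
          exact fun _ => ⟨i, hk⟩
        simp [Finset.mem_symmDiff, this]
      simp only [this])
    have h2 := ENNReal.ofReal_le_ofReal h1
    rw [ENNReal.ofReal_sum_of_nonneg fun _ _ => abs_nonneg _] at h2
    refine le_trans (le_of_eq ?_) h2
    rw [ENNReal.ofReal_mul (by positivity), ENNReal.ofReal_pow (by norm_num)]
    simp only [ENNReal.ofReal_ofNat]
    congr 1
    rw [div_eq_inv_mul, ← one_div, ← ha, Finset.mul_sum,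
      ENNReal.ofReal_sum_of_nonneg fun k _ => mul_nonneg ha0 (hw k), hU, Finset.sum_filter]
    refine Finset.sum_congr rfl fun k _ => ?_
    simp [Set.indicator]
  refine le_trans ?_ (lintegral_mono hpt)
  rw [lintegral_const_mul' _ _ (by simp)]
  refine mul_le_mul_right ?_ _
  rw [lintegral_finsetSum _ fun k _ => measurable_const.indicator (hG k)]
  have : (∑ k, w k) / (8 * √(Fintype.card ι)) = ∑ k, (a * w k) * (1 / 2) := by
    rw [← Finset.sum_mul, ← Finset.mul_sum, ha]
    field_simp
    ring
  rw [this, ENNReal.ofReal_sum_of_nonneg fun k _ => by have := hw k; positivity]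
  refine Finset.sum_le_sum fun k _ => ?_
  rw [lintegral_indicator_const (hG k), ENNReal.ofReal_mul (mul_nonneg ha0 (hw k))]
  gcongr
  exact half_le_pi_forall_notMem ν hn (hE k) (hνE k)

theorem exists_ge_of_card_mul_le_sum {ι : Type*} [Fintype ι] (r : Finset ι → ℝ≥0∞) (b : ℝ≥0∞)
    (h : 2 ^ Fintype.card ι * b ≤ ∑ T, r T) : ∃ T, b ≤ r T := by
  by_contra! hlt
  have : ∑ T, r T < ∑ T : Finset ι, b :=
    ENNReal.sum_lt_sum_of_nonempty ⟨∅, Finset.mem_univ _⟩ fun T _ => hlt T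
  rw [Finset.sum_const, Finset.card_univ, Fintype.card_finset, nsmul_eq_mul] at this
  push_cast at this
  exact absurd h (not_le.2 this)

end Bayes

/-- Lower bound for the minimax risk over a class that contains a locally perturbed family with
additive moments. -/
theorem minimaxRisk_ge {ι : Type*} [DecidableEq ι] [Fintype ι] {d q n : ℕ} (hn : 0 < n)
    {pt ps : (Fin d → ℝ) → ℝ} {C : Set (((Fin d → ℝ) → ℝ) × ((Fin d → ℝ) → ℝ))}
    [IsProbabilityMeasure (densityMeasure d ps)]
    (E : ι → Set (Fin d → ℝ)) (hE : ∀ k, MeasurableSet (E k))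
    (hνE : ∀ k, densityMeasure d ps (E k) ≤ ENNReal.ofReal (1 / (2 * n)))
    (f : Finset ι → (Fin d → ℝ) → ℝ) (hf : ∀ T, Measurable (f T)) (hC : ∀ T, (f T, ps) ∈ C)
    (hloc : ∀ T T' x, (∀ k, x ∈ E k → (k ∈ T ↔ k ∈ T')) → f T x = f T' x)
    (w : ι → ℝ) (hw : ∀ k, 0 ≤ w k) (I₀ : ℝ) (hI : ∀ T, moment d q pt (f T) = I₀ + ∑ k ∈ T, w k) :
    ENNReal.ofReal ((∑ k, w k) / (8 * √(Fintype.card ι))) ≤ minimaxRisk d q n pt C := by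
  refine le_iInf₂ fun H hH => ?_
  have h := average_error_ge (densityMeasure d ps) hn E hE hνE f hf hloc w hw I₀ H hH
  obtain ⟨T, hT⟩ := exists_ge_of_card_mul_le_sum (fun T => risk d q n pt H (f T) ps) _
    (by simpa only [risk, hI] using h)
  exact hT.trans
    (le_iSup₂ (f := fun (v : ((Fin d → ℝ) → ℝ) × ((Fin d → ℝ) → ℝ)) (_ : v ∈ C) =>
      risk d q n pt H v.1 v.2) (f T, ps) (hC T))

/-! ### Classical derivatives as weak derivatives. -/

section ListDeriv

variable {d : ℕ}

/-- The iterated partial derivative along a list of directions, the head being applied last. -/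
noncomputable def listDeriv (l : List (Fin d)) (φ : (Fin d → ℝ) → ℝ) : (Fin d → ℝ) → ℝ :=
  l.foldr partialDeriv φ

/-- The list of directions in which `multiDeriv α` differentiates. -/
def directions (α : Fin d → ℕ) : List (Fin d) :=
  (List.finRange d).flatMap fun i => List.replicate (α i) i

theorem length_directions (α : Fin d → ℕ) : (directions α).length = ∑ i, α i := by
  simp [directions, List.length_flatMap, Fin.sum_univ_def]

theorem listDeriv_append (l l' : List (Fin d)) (φ : (Fin d → ℝ) → ℝ) :
    listDeriv (l ++ l') φ = listDeriv l (listDeriv l' φ) := by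
  simp [listDeriv, List.foldr_append]

theorem listDeriv_replicate (a : ℕ) (i : Fin d) (φ : (Fin d → ℝ) → ℝ) :
    listDeriv (List.replicate a i) φ = (partialDeriv i)^[a] φ := by
  induction a with
  | zero => rfl
  | succ a ih => rw [Function.iterate_succ_apply', ← ih]; rfl

theorem multiDeriv_eq_listDeriv (α : Fin d → ℕ) (φ : (Fin d → ℝ) → ℝ) :
    multiDeriv α φ = listDeriv (directions α) φ := by
  unfold multiDeriv directions
  induction List.finRange d with
  | nil => rfl
  | cons i l ih =>
    rw [List.foldr_cons, ih, List.flatMap_cons, listDeriv_append, listDeriv_replicate]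

theorem _root_.ContDiff.partialDeriv {φ : (Fin d → ℝ) → ℝ} (hφ : ContDiff ℝ ∞ φ) (i : Fin d) :
    ContDiff ℝ ∞ (CovShift.partialDeriv i φ) :=
  (hφ.fderiv_right (m := ∞) (by simp)).clm_apply contDiff_const

theorem _root_.ContDiff.listDeriv {φ : (Fin d → ℝ) → ℝ} (hφ : ContDiff ℝ ∞ φ) (l : List (Fin d)) :
    ContDiff ℝ ∞ (CovShift.listDeriv l φ) := by
  induction l with
  | nil => exact hφ
  | cons i l ih => exact ih.partialDeriv i

theorem tsupport_partialDeriv_subset (i : Fin d) (φ : (Fin d → ℝ) → ℝ) :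
    tsupport (partialDeriv i φ) ⊆ tsupport φ :=
  tsupport_fderiv_apply_subset ℝ _

theorem tsupport_listDeriv_subset (l : List (Fin d)) (φ : (Fin d → ℝ) → ℝ) :
    tsupport (listDeriv l φ) ⊆ tsupport φ := by
  induction l with
  | nil => exact subset_rfl
  | cons i l ih => exact (tsupport_partialDeriv_subset i _).trans ih

theorem _root_.HasCompactSupport.listDeriv {φ : (Fin d → ℝ) → ℝ} (hφ : HasCompactSupport φ)
    (l : List (Fin d)) : HasCompactSupport (CovShift.listDeriv l φ) :=
  hφ.of_isClosed_subset (isClosed_tsupport _) (tsupport_listDeriv_subset l φ)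

theorem integral_mul_partialDeriv {f φ : (Fin d → ℝ) → ℝ} (hf : ContDiff ℝ ∞ f)
    (hφ : ContDiff ℝ ∞ φ) (hs : HasCompactSupport φ) (i : Fin d) :
    ∫ x, f x * partialDeriv i φ x = -∫ x, partialDeriv i f x * φ x := by
  have hs' : HasCompactSupport (partialDeriv i φ) := hs.listDeriv [i]
  refine integral_mul_fderiv_eq_neg_fderiv_mul_of_integrable ?_ ?_ ?_ ?_ ?_
  · exact ((hf.partialDeriv i).continuous.mul hφ.continuous).integrable_of_hasCompactSupport
      hs.mul_left
  · exact (hf.continuous.mul (hφ.partialDeriv i).continuous).integrable_of_hasCompactSupport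
      hs'.mul_left
  · exact (hf.continuous.mul hφ.continuous).integrable_of_hasCompactSupport hs.mul_left
  · exact fun x _ => (hf.differentiable (by simp)).differentiableAt
  · exact fun x _ => (hφ.differentiable (by simp)).differentiableAt

/-- Each integration by parts moves the outermost derivative of `φ` to the innermost place on `f`,
whence the reversed list. Keeping the reversal avoids commuting partial derivatives. -/
theorem integral_mul_listDeriv {f φ : (Fin d → ℝ) → ℝ} (hf : ContDiff ℝ ∞ f)
    (hφ : ContDiff ℝ ∞ φ) (hs : HasCompactSupport φ) (l : List (Fin d)) :
    ∫ x, f x * listDeriv l φ x = (-1) ^ l.length * ∫ x, listDeriv l.reverse f x * φ x := by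
  induction l generalizing f with
  | nil => simp [listDeriv]
  | cons i l ih =>
    have h := integral_mul_partialDeriv hf (hφ.listDeriv l) (hs.listDeriv l) i
    rw [ih (hf.partialDeriv i)] at h
    rw [List.reverse_cons, listDeriv_append, List.length_cons, pow_succ]
    refine h.trans ?_
    simp [listDeriv]

/-- A smooth function has its classical derivatives as weak derivatives. -/
theorem hasWeakDeriv_listDeriv {f : (Fin d → ℝ) → ℝ} (hf : ContDiff ℝ ∞ f) (α : Fin d → ℕ) :
    HasWeakDeriv α f (listDeriv (directions α).reverse f) := by
  intro φ hφ hs hsupp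
  -- Functions supported inside the open cube have the same integral over the cube and over the
  -- whole space, so no boundary terms appear.
  have hout : ∀ (g ψ : (Fin d → ℝ) → ℝ), tsupport ψ ⊆ tsupport φ →
      ∫ x, g x * ψ x ∂(cubeVolume d) = ∫ x, g x * ψ x := by
    intro g ψ hψ
    refine setIntegral_eq_integral_of_forall_compl_eq_zero fun x hx => ?_
    have : x ∉ tsupport ψ := fun h => hx (interior_subset (hsupp (hψ h)))
    rw [image_eq_zero_of_notMem_tsupport this, mul_zero]
  rw [multiDeriv_eq_listDeriv, hout _ _ (tsupport_listDeriv_subset _ _), hout _ _ subset_rfl,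
    integral_mul_listDeriv hf hφ hs, length_directions]

end ListDeriv

/-! ### Sums of rescaled bumps and their Sobolev norms. -/

section BumpSum

variable {d : ℕ} {ι : Type*}

/-- The function `M + c ∑_{k ∈ T} ψ(m x - z k)`. -/
def bumpSum (M c m : ℝ) (z : ι → Fin d → ℝ) (ψ : (Fin d → ℝ) → ℝ) (T : Finset ι) :
    (Fin d → ℝ) → ℝ :=
  fun x => M + c * ∑ k ∈ T, ψ (m • x - z k)

/-- The open cell `{x | m x - z ∈ (0,1)^d}`. -/
def cell (m : ℝ) (z : Fin d → ℝ) : Set (Fin d → ℝ) := {x | m • x - z ∈ interior (cube d)}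

theorem contDiff_bumpSum (M c m : ℝ) (z : ι → Fin d → ℝ) {ψ : (Fin d → ℝ) → ℝ}
    (hψ : ContDiff ℝ ∞ ψ) (T : Finset ι) : ContDiff ℝ ∞ (bumpSum M c m z ψ T) := by
  unfold bumpSum
  refine contDiff_const.add (contDiff_const.mul (ContDiff.sum fun k _ => hψ.comp ?_))
  fun_prop

theorem partialDeriv_bumpSum (M c m : ℝ) (z : ι → Fin d → ℝ) {ψ : (Fin d → ℝ) → ℝ}
    (hψ : ContDiff ℝ ∞ ψ) (T : Finset ι) (i : Fin d) :
    partialDeriv i (bumpSum M c m z ψ T) = bumpSum 0 (c * m) m z (partialDeriv i ψ) T := by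
  funext x
  have h1 : ∀ k ∈ T, HasFDerivAt (fun x => ψ (m • x - z k))
      ((fderiv ℝ ψ (m • x - z k)).comp (m • ContinuousLinearMap.id ℝ (Fin d → ℝ))) x := by
    intro k _
    refine HasFDerivAt.comp x ((hψ.differentiable (by simp)) _).hasFDerivAt ?_
    exact ((hasFDerivAt_id x).const_smul m).sub_const _
  have h2 := ((HasFDerivAt.fun_sum h1).const_mul c).const_add M
  unfold partialDeriv bumpSum
  rw [h2.fderiv]
  simp [Finset.mul_sum, mul_assoc]

/-- Derivatives stay within the family of bump sums: each one costs a factor `m`, and the first one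
kills the constant. -/
theorem listDeriv_bumpSum (M c m : ℝ) (z : ι → Fin d → ℝ) {ψ : (Fin d → ℝ) → ℝ}
    (hψ : ContDiff ℝ ∞ ψ) (T : Finset ι) (l : List (Fin d)) :
    listDeriv l (bumpSum M c m z ψ T) =
      bumpSum (if l = [] then M else 0) (c * m ^ l.length) m z (listDeriv l ψ) T := by
  induction l with
  | nil => simp [listDeriv]
  | cons i l ih =>
    change partialDeriv i (listDeriv l (bumpSum M c m z ψ T)) = _
    rw [ih, partialDeriv_bumpSum _ _ _ _ (hψ.listDeriv l)]
    simp [listDeriv, pow_succ, mul_assoc]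

theorem volume_preimage_smul_sub {m : ℝ} (hm : 0 < m) (z : Fin d → ℝ) (K : Set (Fin d → ℝ)) :
    volume {x : Fin d → ℝ | m • x - z ∈ K} = ENNReal.ofReal ((m ^ d)⁻¹) * volume K := by
  have : {x : Fin d → ℝ | m • x - z ∈ K} = (fun x => m • x) ⁻¹' ((fun x => x + -z) ⁻¹' K) := by
    ext x; simp [sub_eq_add_neg]
  rw [this, Measure.addHaar_preimage_smul _ hm.ne', measure_preimage_add_right]
  simp [abs_of_pos hm]

theorem interior_cube : interior (cube d) = Set.pi Set.univ fun _ => Set.Ioo (0 : ℝ) 1 := by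
  rw [cube, ← Set.pi_univ_Icc, interior_pi_set Set.finite_univ]
  simp

theorem volume_interior_cube : volume (interior (cube d)) = 1 := by
  rw [interior_cube, Real.volume_pi_Ioo]
  simp

theorem volume_cell {m : ℝ} (hm : 0 < m) (z : Fin d → ℝ) :
    volume (cell m z) = ENNReal.ofReal ((m ^ d)⁻¹) := by
  rw [cell, volume_preimage_smul_sub hm, volume_interior_cube, mul_one]

instance (d : ℕ) : IsProbabilityMeasure (cubeVolume d) where
  measure_univ := by
    rw [cubeVolume, Measure.restrict_apply_univ, cube, ← Set.pi_univ_Icc, volume_pi_pi]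
    simp

theorem isOpen_cell (m : ℝ) (z : Fin d → ℝ) : IsOpen (cell m z) :=
  isOpen_interior.preimage (by fun_prop : Continuous fun x : Fin d → ℝ => m • x - z)

/-- At most one bump is active at a point. `F` is the identity for norm bounds and a moment
increment for additivity of the moment. -/
theorem sum_bump_of_mem [DecidableEq ι] {m : ℝ} {z : ι → Fin d → ℝ} {ψ : (Fin d → ℝ) → ℝ}
    (hψ : Function.support ψ ⊆ interior (cube d))
    (hz : Pairwise fun k k' => Disjoint (cell m (z k)) (cell m (z k')))
    {x : Fin d → ℝ} {k : ι} (hx : x ∈ cell m (z k)) (T : Finset ι) (F : ℝ → ℝ) (hF : F 0 = 0) :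
    ∑ k ∈ T, F (ψ (m • x - z k)) = if k ∈ T then F (ψ (m • x - z k)) else 0 := by
  rw [← Finset.sum_ite_eq' T k fun k => F (ψ (m • x - z k))]
  refine Finset.sum_congr rfl fun j _ => ?_
  split_ifs with h
  · rfl
  · have : ψ (m • x - z j) = 0 := by
      by_contra hne
      exact (hz h).le_bot ⟨hψ hne, hx⟩
    rw [this, hF]

theorem bump_eq_zero {m : ℝ} {z : Fin d → ℝ} {ψ : (Fin d → ℝ) → ℝ}
    (hψ : Function.support ψ ⊆ interior (cube d)) {x : Fin d → ℝ} (hx : x ∉ cell m z) :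
    ψ (m • x - z) = 0 := by
  by_contra hne
  exact hx (hψ hne)

/-- The deviation from `M` is at most `c * C` and lives on the cells, whose total volume is at most
`card ι / m ^ d`. -/
theorem eLpNorm_bumpSum_le [Fintype ι] {p M c m C : ℝ} (hp : 1 ≤ p) (hM : 0 ≤ M) (hc : 0 ≤ c)
    (hm : 0 < m) (hC : 0 ≤ C) {z : ι → Fin d → ℝ} {ψ : (Fin d → ℝ) → ℝ} (hψc : Continuous ψ)
    (hψ : Function.support ψ ⊆ interior (cube d)) (hψC : ∀ x, |ψ x| ≤ C)
    (hz : Pairwise fun k k' => Disjoint (cell m (z k)) (cell m (z k'))) (T : Finset ι) :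
    eLpNorm (bumpSum M c m z ψ T) (ENNReal.ofReal p) (cubeVolume d) ≤
      ENNReal.ofReal (M + c * C * (Fintype.card ι / m ^ d) ^ (1 / p)) := by
  classical
  have hp0 : 0 < p := by linarith
  set E : Set (Fin d → ℝ) := ⋃ k, cell m (z k) with hE
  have hEm : MeasurableSet E := (isOpen_iUnion fun k => isOpen_cell m (z k)).measurableSet
  have hvE : cubeVolume d E ≤ ENNReal.ofReal (Fintype.card ι / m ^ d) := by
    refine (Measure.restrict_apply_le _ _).trans ((measure_iUnion_fintype_le _ _).trans ?_)
    simp only [volume_cell hm, Finset.sum_const, Finset.card_univ, nsmul_eq_mul]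
    rw [div_eq_mul_inv, ENNReal.ofReal_mul (by positivity), ENNReal.ofReal_natCast]
  have hpt : ∀ x, ‖bumpSum M c m z ψ T x - M‖ ≤ E.indicator (fun _ => c * C) x := by
    intro x
    simp only [bumpSum, add_sub_cancel_left, Real.norm_eq_abs, abs_mul, abs_of_nonneg hc]
    by_cases hx : x ∈ E
    · rw [Set.indicator_of_mem hx]
      obtain ⟨k, hk⟩ := Set.mem_iUnion.1 hx
      have := sum_bump_of_mem hψ hz hk T id rfl
      simp only [id] at this
      rw [this]
      gcongr
      split_ifs
      · exact hψC _
      · simpa using hC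
    · rw [Set.indicator_of_notMem hx]
      have : ∀ k, ψ (m • x - z k) = 0 := fun k =>
        bump_eq_zero hψ fun h => hx (Set.mem_iUnion.2 ⟨k, h⟩)
      simp [this]
  have hcont : Continuous (bumpSum M c m z ψ T) := by
    unfold bumpSum
    fun_prop
  have hsplit : bumpSum M c m z ψ T = (fun _ => M) + fun x => bumpSum M c m z ψ T x - M := by
    funext x; simp
  have hp1 : (1 : ℝ≥0∞) ≤ ENNReal.ofReal p := by simpa using hp
  rw [hsplit]
  refine (eLpNorm_add_le aestronglyMeasurable_const
    (hcont.sub continuous_const).aestronglyMeasurable hp1).trans ?_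
  rw [ENNReal.ofReal_add hM (by positivity)]
  refine add_le_add ?_ ?_
  · rw [eLpNorm_const' _ (by simpa using hp0) ENNReal.ofReal_ne_top, measure_univ]
    simp [Real.enorm_eq_ofReal hM]
  · refine (eLpNorm_mono_real hpt).trans ?_
    rw [eLpNorm_indicator_const hEm (by simpa using hp0) ENNReal.ofReal_ne_top,
      ENNReal.ofReal_mul (by positivity), Real.enorm_eq_ofReal (by positivity),
      ENNReal.toReal_ofReal hp0.le, ← ENNReal.ofReal_rpow_of_nonneg (by positivity) (by positivity)]
    gcongr

/-- Sobolev bounds for sums of disjointly supported rescaled bumps. -/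
theorem exists_sobolev_bound (d s : ℕ) {p : ℝ} (hp : 1 ≤ p) {ψ : (Fin d → ℝ) → ℝ}
    (hψ : ContDiff ℝ ∞ ψ) (hψs : HasCompactSupport ψ) (hψQ : tsupport ψ ⊆ interior (cube d)) :
    ∃ C : ℝ, 0 < C ∧ ∀ (ι : Type) [Fintype ι] (M A m : ℝ) (z : ι → Fin d → ℝ) (T : Finset ι),
      0 ≤ M → 0 ≤ A → 1 ≤ m →
      (Pairwise fun k k' => Disjoint (cell m (z k)) (cell m (z k'))) →
      MemSobolev d s p (bumpSum M A m z ψ T) ∧ ∀ α ∈ multiIndices d s,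
        weakDerivNorm p α (bumpSum M A m z ψ T) ≤
          ENNReal.ofReal (M + A * m ^ s * C * (Fintype.card ι / m ^ d) ^ (1 / p)) := by
  have hb : ∀ l : List (Fin d), ∃ C : ℝ, 0 < C ∧ ∀ x, |listDeriv l ψ x| ≤ C := by
    intro l
    obtain ⟨C, hC⟩ := (hψs.listDeriv l).exists_bound_of_continuous (hψ.listDeriv l).continuous
    exact ⟨max C 1, by positivity, fun x => (hC x).trans (le_max_left _ _)⟩
  choose b hb0 hb using hb
  -- One constant for all derivatives of order at most `s`; the summand `1` makes positivity
  -- immediate.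
  set C := 1 + ∑ α ∈ multiIndices d s, b (directions α).reverse with hCdef
  have hC1 : 0 < C := by
    have : 0 ≤ ∑ α ∈ multiIndices d s, b (directions α).reverse :=
      Finset.sum_nonneg fun α _ => (hb0 _).le
    linarith
  have hbC : ∀ α ∈ multiIndices d s, b (directions α).reverse ≤ C := by
    intro α hα
    have := Finset.single_le_sum (f := fun α => b (directions α).reverse)
      (fun α _ => (hb0 _).le) hα
    linarith
  refine ⟨C, hC1, fun ι _ M A m z T hM hA hm hz => ?_⟩
  have hm0 : 0 < m := by linarith
  have key : ∀ α ∈ multiIndices d s,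
      MemLp (listDeriv (directions α).reverse (bumpSum M A m z ψ T)) (ENNReal.ofReal p)
        (cubeVolume d) ∧
      eLpNorm (listDeriv (directions α).reverse (bumpSum M A m z ψ T)) (ENNReal.ofReal p)
        (cubeVolume d) ≤
          ENNReal.ofReal (M + A * m ^ s * C * (Fintype.card ι / m ^ d) ^ (1 / p)) := by
    intro α hα
    have hle : eLpNorm (listDeriv (directions α).reverse (bumpSum M A m z ψ T)) (ENNReal.ofReal p)
        (cubeVolume d) ≤
          ENNReal.ofReal (M + A * m ^ s * C * (Fintype.card ι / m ^ d) ^ (1 / p)) := by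
      rw [listDeriv_bumpSum _ _ _ _ hψ]
      refine (eLpNorm_bumpSum_le hp (by split_ifs <;> simp [hM]) (by positivity) hm0 (hb0 _).le
        (hψ.listDeriv _).continuous
        ((subset_tsupport _).trans ((tsupport_listDeriv_subset _ _).trans hψQ))
        (hb (directions α).reverse) hz T).trans ?_
      apply ENNReal.ofReal_le_ofReal
      have hα' : (directions α).reverse.length ≤ s := by
        rw [List.length_reverse, length_directions]
        exact (Finset.mem_filter.1 hα).2
      gcongr
      · split_ifs <;> simp [hM]
      · exact (hb0 _).le
      · exact hbC α hα
    exact ⟨⟨((contDiff_bumpSum M A m z hψ T).listDeriv _).continuous.aestronglyMeasurable,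
      hle.trans_lt ENNReal.ofReal_lt_top⟩, hle⟩
  have hweak := fun α => hasWeakDeriv_listDeriv (contDiff_bumpSum M A m z hψ T) α
  refine ⟨⟨?_, fun α hα => ⟨_, (key α hα).1, hweak α⟩⟩, fun α hα => ?_⟩
  · have h0 : (0 : Fin d → ℕ) ∈ multiIndices d s := by simp [multiIndices]
    have := (key 0 h0).1
    have hnil : directions (0 : Fin d → ℕ) = [] := by
      rw [← List.length_eq_zero_iff, length_directions]; simp
    simpa [hnil, listDeriv] using this
  · refine le_trans ?_ (key α hα).2
    exact iInf_le_of_le _ (iInf_le_of_le (key α hα).1 (iInf_le_of_le (hweak α) le_rfl))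

theorem sobolevNorm_le_of_weakDerivNorm_le {s : ℕ} {p κ : ℝ} (hp : 1 ≤ p)
    {f : (Fin d → ℝ) → ℝ} (h : ∀ α ∈ multiIndices d s, weakDerivNorm p α f ≤ ENNReal.ofReal κ) :
    sobolevNorm d s p f ≤ ENNReal.ofReal ((multiIndices d s).card * κ) := by
  have hp0 : 0 < p := by linarith
  have hJ : 1 ≤ (multiIndices d s).card :=
    Finset.card_pos.2 ⟨0, by simp [multiIndices]⟩
  calc sobolevNorm d s p f
      ≤ (∑ α ∈ multiIndices d s, ENNReal.ofReal κ ^ p) ^ (1 / p) := by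
        unfold sobolevNorm
        gcongr with α hα
        exact h α hα
    _ = ((multiIndices d s).card : ℝ≥0∞) ^ (1 / p) * ENNReal.ofReal κ := by
        rw [Finset.sum_const, nsmul_eq_mul, ENNReal.mul_rpow_of_nonneg _ _ (by positivity),
          ← ENNReal.rpow_mul, mul_one_div_cancel hp0.ne', ENNReal.rpow_one]
    _ ≤ ((multiIndices d s).card : ℝ≥0∞) * ENNReal.ofReal κ := by
        gcongr
        refine (ENNReal.rpow_le_rpow_of_exponent_le (by exact_mod_cast hJ)
          (?_ : 1 / p ≤ 1)).trans (by simp)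
        rw [div_le_one hp0]; exact hp
    _ = _ := by rw [ENNReal.ofReal_mul (by positivity), ENNReal.ofReal_natCast]

end BumpSum

/-! ### Measures with bounded density. -/

section Density

variable {d : ℕ} {ρ : (Fin d → ℝ) → ℝ}

theorem measurableSet_cube : MeasurableSet (cube d) := measurableSet_Icc

theorem IsDensity.isProbabilityMeasure (h : IsDensity d ρ) :
    IsProbabilityMeasure (densityMeasure d ρ) where
  measure_univ := by
    rw [densityMeasure, withDensity_apply _ MeasurableSet.univ, Measure.restrict_univ,
      h.lintegral_eq_one]

theorem densityMeasure_le {b : ℝ} (hb : ∀ x ∈ cube d, ρ x ≤ b) {E : Set (Fin d → ℝ)}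
    (hE : MeasurableSet E) : densityMeasure d ρ E ≤ ENNReal.ofReal b * cubeVolume d E := by
  rw [densityMeasure, withDensity_apply _ hE]
  calc ∫⁻ x in E, ENNReal.ofReal (ρ x) ∂(cubeVolume d)
      ≤ ∫⁻ _ in E, ENNReal.ofReal b ∂(cubeVolume d) := by
        refine lintegral_mono_ae (ae_restrict_of_ae ?_)
        filter_upwards [ae_restrict_mem measurableSet_cube] with x hx
        exact ENNReal.ofReal_le_ofReal (hb x hx)
    _ = _ := by rw [setLIntegral_const]

end Density

/-! ### The cutoff function. -/

section Bump

/-- A smooth cutoff function of the open unit cube that is `1` up to a set of small volume. -/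
theorem exists_bump (d : ℕ) {δ : ℝ} (hδ : 0 < δ) :
    ∃ (ψ : (Fin d → ℝ) → ℝ) (K : Set (Fin d → ℝ)), ContDiff ℝ ∞ ψ ∧ HasCompactSupport ψ ∧
      tsupport ψ ⊆ interior (cube d) ∧ (∀ x, 0 ≤ ψ x) ∧ IsCompact K ∧ K ⊆ interior (cube d) ∧
      (∀ x ∈ K, ψ x = 1) ∧ ENNReal.ofReal (1 - δ) ≤ volume K := by
  have hlt : ENNReal.ofReal (1 - δ) < volume (interior (cube d)) := by
    rw [volume_interior_cube, ENNReal.ofReal_lt_one]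
    linarith
  obtain ⟨K, hKQ, hK, hvol⟩ := isOpen_interior.exists_lt_isCompact hlt
  obtain ⟨K', hK', hKK', hK'Q⟩ := exists_compact_between hK isOpen_interior hKQ
  obtain ⟨ψ, h1, h0, h01⟩ := exists_contMDiffMap_one_nhds_of_subset_interior (n := ⊤)
    (modelWithCornersSelf ℝ (Fin d → ℝ)) hK.isClosed hKK'
  have hsupp : tsupport ψ ⊆ K' :=
    closure_minimal (fun x hx => by_contra fun h => hx (h0 x h)) hK'.isClosed
  exact ⟨ψ, K, ψ.contMDiff.contDiff, hK'.of_isClosed_subset (isClosed_tsupport _) hsupp,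
    hsupp.trans hK'Q, fun x => (h01 x).1, hK, hKQ, fun x hx => h1.self_of_nhdsSet x hx, hvol.le⟩

end Bump

/-! ### Grid cells and the target mass of their cores. -/

section Grid

variable {d m : ℕ}

/-- The grid point with integer coordinates `k`. -/
def gridPoint (k : Fin d → Fin m) : Fin d → ℝ := fun i => (k i : ℕ)

/-- A point determines the index of its cell, which gives disjointness. -/
theorem floor_of_mem_cell {k : Fin d → Fin m} {x : Fin d → ℝ} (hx : x ∈ cell m (gridPoint k))
    (i : Fin d) : ⌊(m : ℝ) * x i⌋₊ = k i := by
  rw [cell, interior_cube] at hx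
  have h := hx i (Set.mem_univ i)
  simp only [Pi.sub_apply, Pi.smul_apply, smul_eq_mul, gridPoint, Set.mem_Ioo] at h
  rw [Nat.floor_eq_iff (by have : (0 : ℝ) ≤ (k i : ℕ) := by positivity
                           linarith [h.1])]
  constructor <;> linarith [h.1, h.2]

theorem pairwise_disjoint_cell :
    Pairwise fun k k' : Fin d → Fin m =>
      Disjoint (cell m (gridPoint k)) (cell m (gridPoint k')) := by
  intro k k' hne
  rw [Set.disjoint_left]
  intro x hx hx'
  refine hne (funext fun i => Fin.ext ?_)
  rw [← floor_of_mem_cell hx i, floor_of_mem_cell hx' i]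

theorem cell_subset_cube (hm : 0 < m) (k : Fin d → Fin m) : cell m (gridPoint k) ⊆ cube d := by
  intro x hx
  rw [cell, interior_cube] at hx
  have hm' : (0 : ℝ) < m := by exact_mod_cast hm
  rw [cube, ← Set.pi_univ_Icc]
  intro i _
  have h := hx i (Set.mem_univ i)
  simp only [Pi.sub_apply, Pi.smul_apply, smul_eq_mul, gridPoint, Set.mem_Ioo] at h
  have hk : ((k i : ℕ) : ℝ) + 1 ≤ m := by exact_mod_cast (k i).2
  have hk0 : (0 : ℝ) ≤ (k i : ℕ) := by positivity
  simp only [Pi.zero_apply, Pi.one_apply, Set.mem_Icc]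
  constructor
  · by_contra! hneg
    have := mul_neg_of_pos_of_neg hm' hneg
    linarith
  · by_contra! hgt
    have := mul_lt_mul_of_pos_left hgt hm'
    linarith

/-- The rescaled copy of `K` in the cell of `k`. -/
def core (K : Set (Fin d → ℝ)) (k : Fin d → Fin m) : Set (Fin d → ℝ) :=
  {x | (m : ℝ) • x - gridPoint k ∈ K}

theorem core_subset_cell {K : Set (Fin d → ℝ)} (hK : K ⊆ interior (cube d)) (k : Fin d → Fin m) :
    core K k ⊆ cell m (gridPoint k) := fun _ hx => hK hx

theorem measurableSet_core {K : Set (Fin d → ℝ)} (hK : IsCompact K) (k : Fin d → Fin m) :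
    MeasurableSet (core K k) :=
  (hK.isClosed.preimage
    (by fun_prop : Continuous fun x : Fin d → ℝ => (m : ℝ) • x - gridPoint k)).measurableSet

/-- A bounded probability density gives mass at least `1 / 2` to the union of the cores, when these
fill the cells up to a small fraction. -/
theorem half_le_sum_core {pt : (Fin d → ℝ) → ℝ} (hpt : IsDensity d pt) {β : ℝ} (hβ : 0 < β)
    (hb : ∀ x ∈ cube d, pt x ≤ β) (hm : 0 < m) {K : Set (Fin d → ℝ)} (hK : IsCompact K)
    (hKQ : K ⊆ interior (cube d)) (hKv : ENNReal.ofReal (1 - 1 / (2 * β)) ≤ volume K) :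
    1 / 2 ≤ ∑ k : Fin d → Fin m, (densityMeasure d pt).real (core K k) := by
  have := hpt.isProbabilityMeasure
  have hm' : (0 : ℝ) < m := by exact_mod_cast hm
  set W : Set (Fin d → ℝ) := ⋃ k : Fin d → Fin m, core K k with hW
  have hdisj : Pairwise (Function.onFun Disjoint fun k : Fin d → Fin m => core K k) :=
    fun k k' hne => (pairwise_disjoint_cell hne).mono (core_subset_cell hKQ k)
      (core_subset_cell hKQ k')
  have hWm : MeasurableSet W := MeasurableSet.iUnion fun k => measurableSet_core hK k
  have hsum : (densityMeasure d pt).real W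
      = ∑ k : Fin d → Fin m, (densityMeasure d pt).real (core K k) :=
    measureReal_iUnion_fintype hdisj fun k => measurableSet_core hK k
  have hvW : volume W = volume K := by
    rw [hW, measure_iUnion hdisj fun k => measurableSet_core hK k, tsum_fintype]
    simp only [core, volume_preimage_smul_sub hm', Finset.sum_const, Finset.card_univ,
      Fintype.card_fun, Fintype.card_fin, nsmul_eq_mul]
    rw [← mul_assoc, ← ENNReal.ofReal_natCast, ← ENNReal.ofReal_mul (by positivity)]
    push_cast
    rw [mul_inv_cancel₀ (by positivity), ENNReal.ofReal_one, one_mul]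
  have hcW : ENNReal.ofReal (1 - 1 / (2 * β)) ≤ cubeVolume d W := by
    rw [cubeVolume, Measure.restrict_apply hWm, Set.inter_eq_left.2, hvW]
    · exact hKv
    · exact Set.iUnion_subset fun k => (core_subset_cell hKQ k).trans (cell_subset_cube hm k)
  -- The cores miss volume at most `1 / (2β)`; a density bounded by `β` gives this at most mass `1 /
  -- 2`.
  have hcompl : cubeVolume d Wᶜ ≤ ENNReal.ofReal (1 / (2 * β)) := by
    rw [prob_compl_eq_one_sub hWm, tsub_le_iff_right]
    refine le_trans ?_ (add_le_add_right hcW _)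
    refine le_trans ?_ ENNReal.ofReal_add_le
    simp
  have hP : (densityMeasure d pt).real Wᶜ ≤ 1 / 2 := by
    refine ENNReal.toReal_le_of_le_ofReal (by norm_num) ((densityMeasure_le hb hWm.compl).trans ?_)
    calc ENNReal.ofReal β * cubeVolume d Wᶜ
        ≤ ENNReal.ofReal β * ENNReal.ofReal (1 / (2 * β)) := by gcongr
      _ = ENNReal.ofReal (1 / 2) := by
        rw [← ENNReal.ofReal_mul hβ.le]
        congr 1
        field_simp
  rw [← hsum]
  rw [probReal_compl_eq_one_sub hWm] at hP
  linarith

end Grid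

/-! ### Additivity and size of the moment increments. -/

section Moments

variable {d q m : ℕ} {ι : Type*}

/-- The increment of the `q`-th moment of the constant `M` caused by adding one bump. -/
noncomputable def bumpMoment (q : ℕ) (M A m : ℝ) (ψ pt : (Fin d → ℝ) → ℝ) (z : Fin d → ℝ) : ℝ :=
  ∫ x, ((M + A * ψ (m • x - z)) ^ q - M ^ q) ∂(densityMeasure d pt)

theorem integrable_bumpMoment {pt : (Fin d → ℝ) → ℝ} (hpt : IsDensity d pt) (q : ℕ) (M A m : ℝ)
    {ψ : (Fin d → ℝ) → ℝ} (hψ : Continuous ψ) (hψs : HasCompactSupport ψ) (z : Fin d → ℝ) :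
    Integrable (fun x => (M + A * ψ (m • x - z)) ^ q - M ^ q) (densityMeasure d pt) := by
  have := hpt.isProbabilityMeasure
  obtain ⟨C, hC⟩ := hψs.exists_bound_of_continuous hψ
  have hcont : Continuous fun x : Fin d → ℝ => (M + A * ψ (m • x - z)) ^ q - M ^ q := by fun_prop
  refine Integrable.of_bound hcont.aestronglyMeasurable ((|M| + |A| * C) ^ q + |M| ^ q)
    (Filter.Eventually.of_forall fun x => ?_)
  refine (norm_sub_le _ _).trans ?_
  rw [norm_pow, norm_pow]
  gcongr
  · refine (norm_add_le _ _).trans ?_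
    rw [norm_mul]
    gcongr
    · exact le_rfl
    · exact le_rfl
    · exact hC _
  · exact le_rfl

theorem moment_bumpSum [DecidableEq ι] {pt : (Fin d → ℝ) → ℝ} (hpt : IsDensity d pt) (q : ℕ)
    (M A m : ℝ) {ψ : (Fin d → ℝ) → ℝ} (hψ : Continuous ψ) (hψs : HasCompactSupport ψ)
    (hψQ : tsupport ψ ⊆ interior (cube d)) {z : ι → Fin d → ℝ}
    (hz : Pairwise fun k k' => Disjoint (cell m (z k)) (cell m (z k'))) (T : Finset ι) :
    moment d q pt (bumpSum M A m z ψ T) = M ^ q + ∑ k ∈ T, bumpMoment q M A m ψ pt (z k) := by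
  have := hpt.isProbabilityMeasure
  have hsupp := (subset_tsupport ψ).trans hψQ
  have hpoint : ∀ x, bumpSum M A m z ψ T x ^ q
      = M ^ q + ∑ k ∈ T, ((M + A * ψ (m • x - z k)) ^ q - M ^ q) := by
    intro x
    by_cases hx : ∃ k, x ∈ cell m (z k)
    · obtain ⟨k, hk⟩ := hx
      have h1 := sum_bump_of_mem hsupp hz hk T id rfl
      have h2 := sum_bump_of_mem hsupp hz hk T (fun t => (M + A * t) ^ q - M ^ q) (by simp)
      simp only [id] at h1
      rw [h2, bumpSum, h1]
      split_ifs <;> simp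
    · have h0 : ∀ k, ψ (m • x - z k) = 0 := fun k => bump_eq_zero hsupp fun h => hx ⟨k, h⟩
      simp [bumpSum, h0]
  have hint := fun k => integrable_bumpMoment hpt q M A m hψ hψs (z k)
  simp only [moment, hpoint]
  rw [integral_add (integrable_const _) (integrable_finsetSum _ fun k _ => hint k),
    integral_finsetSum _ fun k _ => hint k]
  simp [bumpMoment]

/-- The integrand is nonnegative because `M`, `A` and `ψ` are, and it equals `(M + A) ^ q - M ^ q`
on the core, where `ψ = 1`. -/
theorem bumpMoment_ge {pt : (Fin d → ℝ) → ℝ} (hpt : IsDensity d pt) (q : ℕ) {M A : ℝ} (hM : 0 ≤ M)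
    (hA : 0 ≤ A) {ψ : (Fin d → ℝ) → ℝ} (hψ : Continuous ψ) (hψs : HasCompactSupport ψ)
    (hψ0 : ∀ x, 0 ≤ ψ x) {K : Set (Fin d → ℝ)} (hK : IsCompact K) (hK1 : ∀ x ∈ K, ψ x = 1)
    (k : Fin d → Fin m) :
    ((M + A) ^ q - M ^ q) * (densityMeasure d pt).real (core K k) ≤
      bumpMoment q M A m ψ pt (gridPoint k) := by
  have := hpt.isProbabilityMeasure
  rw [mul_comm, ← smul_eq_mul, ← integral_indicator_const _ (measurableSet_core hK k)]
  refine integral_mono ((integrable_const _).indicator (measurableSet_core hK k))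
    (integrable_bumpMoment hpt q M A m hψ hψs _) fun x => ?_
  by_cases hx : x ∈ core K k
  · rw [Set.indicator_of_mem hx]
    simp only [core, Set.mem_ofPred_eq] at hx
    simp [hK1 _ hx]
  · rw [Set.indicator_of_notMem hx, sub_nonneg]
    exact pow_le_pow_left₀ hM (le_add_of_nonneg_right (mul_nonneg hA (hψ0 _))) q

end Moments

/-! ### Risk bounds from one bump and from all bumps. -/

/-- The minimax lower bound obtained from the bumps on a set of grid cells. -/
theorem minimaxRisk_ge_of_bumpSum {ι : Type*} [DecidableEq ι] [Fintype ι] {d q m n : ℕ} (hn : 0 < n)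
    (hm : 0 < m) {pt ps : (Fin d → ℝ) → ℝ} (hpt : IsDensity d pt) (hps : IsDensity d ps) {bu : ℝ}
    (hbu : 0 ≤ bu) (hpsb : ∀ x ∈ cube d, ps x ≤ bu) (hmn : 2 * bu * n ≤ (m : ℝ) ^ d)
    {ψ : (Fin d → ℝ) → ℝ} {K : Set (Fin d → ℝ)} (hψ : ContDiff ℝ ∞ ψ) (hψs : HasCompactSupport ψ)
    (hψQ : tsupport ψ ⊆ interior (cube d)) (hψ0 : ∀ x, 0 ≤ ψ x) (hK : IsCompact K)
    (hK1 : ∀ x ∈ K, ψ x = 1) {e : ι → Fin d → Fin m} (he : Function.Injective e)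
    {C : Set (((Fin d → ℝ) → ℝ) × ((Fin d → ℝ) → ℝ))} {M A : ℝ} (hM : 0 ≤ M) (hA : 0 ≤ A)
    (hC : ∀ T, (bumpSum M A m (fun k => gridPoint (e k)) ψ T, ps) ∈ C) :
    ENNReal.ofReal (((M + A) ^ q - M ^ q) * (∑ k, (densityMeasure d pt).real (core K (e k))) /
      (8 * √(Fintype.card ι))) ≤ minimaxRisk d q n pt C := by
  have := hps.isProbabilityMeasure
  have hm' : (0 : ℝ) < m := by exact_mod_cast hm
  have hn' : (0 : ℝ) < n := by exact_mod_cast hn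
  have hz : Pairwise fun k k' : ι =>
      Disjoint (cell (m : ℝ) (gridPoint (e k))) (cell m (gridPoint (e k'))) :=
    fun k k' hne => pairwise_disjoint_cell (he.ne hne)
  have hD : 0 ≤ (M + A) ^ q - M ^ q :=
    sub_nonneg.2 (pow_le_pow_left₀ hM (le_add_of_nonneg_right hA) q)
  have hw := fun k : ι => bumpMoment_ge hpt q hM hA hψ.continuous hψs hψ0 hK hK1 (e k)
  refine le_trans (ENNReal.ofReal_le_ofReal ?_)
    (minimaxRisk_ge (q := q) (pt := pt) (ps := ps) hn (fun k => cell m (gridPoint (e k)))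
      (fun k => (isOpen_cell _ _).measurableSet) ?_
      (fun T => bumpSum M A m (fun k => gridPoint (e k)) ψ T)
      (fun T => (contDiff_bumpSum M A m _ hψ T).continuous.measurable) hC ?_
      (fun k => bumpMoment q M A m ψ pt (gridPoint (e k)))
      (fun k => (mul_nonneg hD measureReal_nonneg).trans (hw k)) (M ^ q)
      (fun T => moment_bumpSum hpt q M A m hψ.continuous hψs hψQ hz T))
  · rw [Finset.mul_sum]
    gcongr with k _
    exact hw k
  · intro k
    refine (densityMeasure_le hpsb (isOpen_cell _ _).measurableSet).trans ?_
    calc ENNReal.ofReal bu * cubeVolume d (cell m (gridPoint (e k)))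
        ≤ ENNReal.ofReal bu * ENNReal.ofReal (((m : ℝ) ^ d)⁻¹) := by
          gcongr
          exact (Measure.restrict_apply_le _ _).trans (volume_cell hm' _).le
      _ = ENNReal.ofReal (bu / (m : ℝ) ^ d) := by rw [← ENNReal.ofReal_mul hbu, div_eq_mul_inv]
      _ ≤ _ := by
          apply ENNReal.ofReal_le_ofReal
          rw [div_le_div_iff₀ (by positivity) (by positivity)]
          linarith
  · intro T T' x hx
    simp only [bumpSum]
    have hite : ∀ S : Finset ι, ∑ k ∈ S, ψ ((m : ℝ) • x - gridPoint (e k))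
        = ∑ k, if k ∈ S then ψ ((m : ℝ) • x - gridPoint (e k)) else 0 := fun S => by
      simp [Finset.sum_ite_mem]
    rw [hite T, hite T']
    congr 2
    refine Finset.sum_congr rfl fun k _ => ?_
    by_cases hk : x ∈ cell m (gridPoint (e k))
    · simp [hx k hk]
    · simp [bump_eq_zero ((subset_tsupport ψ).trans hψQ) hk]

theorem one_le_of_density_le {d : ℕ} {ρ : (Fin d → ℝ) → ℝ} (h : IsDensity d ρ) {b : ℝ}
    (hb : ∀ x ∈ cube d, ρ x ≤ b) : 1 ≤ b := by
  have := h.isProbabilityMeasure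
  have h1 := densityMeasure_le hb MeasurableSet.univ
  rw [measure_univ, measure_univ, mul_one] at h1
  simpa using h1

/-- The lower bound on `m ^ d` makes the cells light enough to be missed; the upper one keeps their
number of order `n`. Rounding up costs a factor `2` per coordinate because the rounded number is at
least `1`. -/
theorem exists_grid_size {d n : ℕ} (hd : 0 < d) (hn : 0 < n) {b : ℝ} (hb : 1 ≤ b) :
    ∃ m : ℕ, 0 < m ∧ 2 * b * n ≤ (m : ℝ) ^ d ∧ (m : ℝ) ^ d ≤ 2 ^ d * (2 * b) * n := by
  have hn' : (1 : ℝ) ≤ n := by exact_mod_cast hn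
  have hx : 1 ≤ 2 * b * n := by nlinarith
  set y : ℝ := (2 * b * n) ^ ((d : ℝ)⁻¹) with hy
  have hyd : y ^ d = 2 * b * n := Real.rpow_inv_natCast_pow (by linarith) hd.ne'
  have hy1 : 1 ≤ y := Real.one_le_rpow hx (by positivity)
  refine ⟨⌈y⌉₊, Nat.ceil_pos.2 (by linarith), ?_, ?_⟩
  · rw [← hyd]
    exact pow_le_pow_left₀ (by linarith) (Nat.le_ceil y) d
  · have hle : (⌈y⌉₊ : ℝ) ≤ 2 * y := by
      have := Nat.ceil_lt_add_one (show 0 ≤ y by linarith)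
      linarith
    calc (⌈y⌉₊ : ℝ) ^ d ≤ (2 * y) ^ d := by gcongr
      _ = _ := by rw [mul_pow, hyd]; ring

/-- Two-point lower bound from one bump on the heaviest core. -/
theorem minimaxRisk_ge_single {d q m n : ℕ} (hn : 0 < n) (hq : q ≠ 0)
    (hm : 0 < m) {pt ps : (Fin d → ℝ) → ℝ} (hpt : IsDensity d pt) (hps : IsDensity d ps) {bu : ℝ}
    (hbu : 0 ≤ bu) (hpsb : ∀ x ∈ cube d, ps x ≤ bu) (hmn : 2 * bu * n ≤ (m : ℝ) ^ d)
    {ψ : (Fin d → ℝ) → ℝ} {K : Set (Fin d → ℝ)} (hψ : ContDiff ℝ ∞ ψ) (hψs : HasCompactSupport ψ)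
    (hψQ : tsupport ψ ⊆ interior (cube d)) (hψ0 : ∀ x, 0 ≤ ψ x) (hK : IsCompact K)
    (hK1 : ∀ x ∈ K, ψ x = 1)
    (hhalf : 1 / 2 ≤ ∑ k : Fin d → Fin m, (densityMeasure d pt).real (core K k))
    {C : Set (((Fin d → ℝ) → ℝ) × ((Fin d → ℝ) → ℝ))} {A : ℝ} (hA : 0 ≤ A)
    (hC : ∀ (k : Fin d → Fin m) (T : Finset Unit),
      (bumpSum 0 A m (fun _ => gridPoint k) ψ T, ps) ∈ C) :
    ENNReal.ofReal (A ^ q / (16 * (m : ℝ) ^ d)) ≤ minimaxRisk d q n pt C := by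
  have hm' : (0 : ℝ) < m := by exact_mod_cast hm
  -- Pigeonhole: total core mass `1 / 2` shared by `m ^ d` cores.
  obtain ⟨k, hk⟩ : ∃ k : Fin d → Fin m,
      1 / (2 * (m : ℝ) ^ d) ≤ (densityMeasure d pt).real (core K k) := by
    by_contra! hlt
    have hne : (Finset.univ : Finset (Fin d → Fin m)).Nonempty :=
      ⟨fun _ => ⟨0, hm⟩, Finset.mem_univ _⟩
    have := Finset.sum_lt_sum_of_nonempty hne fun k _ => hlt k
    rw [Finset.sum_const, Finset.card_univ, Fintype.card_fun, Fintype.card_fin, Fintype.card_fin,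
      nsmul_eq_mul] at this
    push_cast at this
    have h2 : (m : ℝ) ^ d * (1 / (2 * (m : ℝ) ^ d)) = 1 / 2 := by field_simp
    linarith
  refine le_trans (ENNReal.ofReal_le_ofReal ?_)
    (minimaxRisk_ge_of_bumpSum (ι := Unit) (q := q) hn hm hpt hps hbu hpsb hmn hψ hψs hψQ hψ0 hK
      hK1 (e := fun _ => k) (fun _ _ _ => rfl) le_rfl hA (hC k))
  simp only [zero_add, zero_pow hq, sub_zero, Finset.univ_unique, Finset.sum_const,
    Finset.card_singleton, one_smul, Fintype.card_unit, Nat.cast_one, Real.sqrt_one, mul_one]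
  calc A ^ q / (16 * (m : ℝ) ^ d) = A ^ q * (1 / (2 * (m : ℝ) ^ d)) / 8 := by field_simp; ring
    _ ≤ _ := by gcongr

/-- Lower bound from independent bumps on all cells of the grid. -/
theorem minimaxRisk_ge_all {d q m n : ℕ} (hn : 0 < n)
    (hm : 0 < m) {pt ps : (Fin d → ℝ) → ℝ} (hpt : IsDensity d pt) (hps : IsDensity d ps) {bu : ℝ}
    (hbu : 0 ≤ bu) (hpsb : ∀ x ∈ cube d, ps x ≤ bu) (hmn : 2 * bu * n ≤ (m : ℝ) ^ d)
    {ψ : (Fin d → ℝ) → ℝ} {K : Set (Fin d → ℝ)} (hψ : ContDiff ℝ ∞ ψ) (hψs : HasCompactSupport ψ)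
    (hψQ : tsupport ψ ⊆ interior (cube d)) (hψ0 : ∀ x, 0 ≤ ψ x) (hK : IsCompact K)
    (hK1 : ∀ x ∈ K, ψ x = 1)
    (hhalf : 1 / 2 ≤ ∑ k : Fin d → Fin m, (densityMeasure d pt).real (core K k))
    {C : Set (((Fin d → ℝ) → ℝ) × ((Fin d → ℝ) → ℝ))} {M A : ℝ} (hM : 0 ≤ M) (hA : 0 ≤ A)
    (hC : ∀ T : Finset (Fin d → Fin m), (bumpSum M A m gridPoint ψ T, ps) ∈ C) :
    ENNReal.ofReal (((M + A) ^ q - M ^ q) / (16 * √((m : ℝ) ^ d))) ≤ minimaxRisk d q n pt C := by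
  have hm' : (0 : ℝ) < m := by exact_mod_cast hm
  have hD : 0 ≤ (M + A) ^ q - M ^ q :=
    sub_nonneg.2 (pow_le_pow_left₀ hM (le_add_of_nonneg_right hA) q)
  refine le_trans (ENNReal.ofReal_le_ofReal ?_)
    (minimaxRisk_ge_of_bumpSum (q := q) hn hm hpt hps hbu hpsb hmn hψ hψs hψQ hψ0 hK
      hK1 (e := fun k : Fin d → Fin m => k) (fun _ _ h => h) hM hA hC)
  rw [Fintype.card_fun, Fintype.card_fin, Fintype.card_fin]
  push_cast
  calc ((M + A) ^ q - M ^ q) / (16 * √((m : ℝ) ^ d))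
      = ((M + A) ^ q - M ^ q) * (1 / 2) / (8 * √((m : ℝ) ^ d)) := by field_simp; ring
    _ ≤ _ := by gcongr

theorem pairwise_disjoint_cell_unit {d : ℕ} (m : ℝ) (z : Unit → Fin d → ℝ) :
    Pairwise fun k k' => Disjoint (cell m (z k)) (cell m (z k')) :=
  fun k k' h => absurd (Subsingleton.elim k k') h

/-! ### Infinite risk without a norm bound. -/

section ShiftClass

variable {d s : ℕ} {p bl bu B : ℝ} {pt f ps : (Fin d → ℝ) → ℝ}

theorem target_le (hbl : 0 < bl) (hB : 1 ≤ B)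
    (h : (f, ps, pt) ∈ shiftClass d s p bl bu B) : ∀ x ∈ cube d, pt x ≤ B * bu := by
  obtain ⟨-, -, -, h1, h2⟩ := h
  intro x hx
  have hps : 0 < ps x := hbl.trans_le (h1 x hx).1
  have := (div_le_iff₀ hps).1 (h2 x hx)
  exact this.trans (mul_le_mul_of_nonneg_left (h1 x hx).2 (by linarith))

theorem mem_shiftClassAt_of_memSobolev (h : (f, ps, pt) ∈ shiftClass d s p bl bu B)
    {g : (Fin d → ℝ) → ℝ} (hg : MemSobolev d s p g) : (g, ps) ∈ shiftClassAt d s p bl bu B pt :=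
  ⟨hg, h.2⟩

/-- Without a bound on the Sobolev norm the minimax risk is infinite. -/
theorem minimaxRisk_shiftClassAt_eq_top {q n : ℕ} (hd : 0 < d) (hp : 1 ≤ p) (hq : q ≠ 0)
    (hbl : 0 < bl) (hB : 1 ≤ B) (h : (f, ps, pt) ∈ shiftClass d s p bl bu B) (hn : 0 < n) :
    minimaxRisk d q n pt (shiftClassAt d s p bl bu B pt) = ⊤ := by
  have hps := h.2.1
  have hpt := h.2.2.1
  have hpsb : ∀ x ∈ cube d, ps x ≤ bu := fun x hx => (h.2.2.2.1 x hx).2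
  have hbu := one_le_of_density_le hps hpsb
  have hβ : 0 < B * bu := by positivity
  obtain ⟨ψ, K, hψ, hψs, hψQ, hψ0, hK, hKQ, hK1, hKv⟩ :=
    exists_bump d (δ := 1 / (2 * (B * bu))) (by positivity)
  obtain ⟨C, -, hSob⟩ := exists_sobolev_bound d s hp hψ hψs hψQ
  obtain ⟨m, hm, hmn, -⟩ := exists_grid_size hd hn hbu
  have hm' : (1 : ℝ) ≤ m := by exact_mod_cast hm
  have hhalf := half_le_sum_core hpt hβ (target_le hbl hB h) hm hK hKQ hKv
  refine ENNReal.eq_top_of_forall_nnreal_le fun r => ?_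
  -- With `A ≥ 1` and `q ≥ 1`, `A ^ q ≥ A` exceeds `16 * m ^ d * r`, so the one-bump bound beats the
  -- arbitrary `r`.
  set A : ℝ := 1 + 16 * (m : ℝ) ^ d * r with hAdef
  have hA1 : 1 ≤ A := by
    have : (0 : ℝ) ≤ 16 * (m : ℝ) ^ d * r := by positivity
    linarith
  refine le_trans ?_ (minimaxRisk_ge_single hn hq hm hpt hps (by linarith) hpsb hmn hψ hψs hψQ hψ0
    hK hK1 hhalf (A := A) (by linarith) fun k T => mem_shiftClassAt_of_memSobolev h
      (hSob Unit 0 A m (fun _ => gridPoint k) T le_rfl (by linarith) hm'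
        (pairwise_disjoint_cell_unit _ _)).1)
  rw [← ENNReal.ofReal_coe_nnreal]
  apply ENNReal.ofReal_le_ofReal
  rw [le_div_iff₀ (by positivity)]
  have := le_self_pow₀ hA1 hq
  linarith

end ShiftClass

/-! ### The two rates on a Sobolev ball. -/

/-- Both rates on a Sobolev ball. -/
theorem exists_minimaxRisk_ball_ge {d s q : ℕ} {p : ℝ} (hd : 0 < d) (hp : 1 ≤ p) (hq : q ≠ 0)
    (hqp : (q : ℝ) ≤ p) {bl bu B L : ℝ} (hbl : 0 < bl) (hbu : bl ≤ bu) (hB : 1 ≤ B) (hL : 0 < L) :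
    ∃ c : ℝ, 0 < c ∧
      ∀ pt : (Fin d → ℝ) → ℝ, (∃ f ps, (f, ps, pt) ∈ shiftClass d s p bl bu B) →
        ∀ n : ℕ, 0 < n →
          ENNReal.ofReal (c * (n : ℝ) ^ (-(q : ℝ) * ((s : ℝ) / d - 1 / p) - 1)) ≤
            minimaxRisk d q n pt (shiftClassBallAt d s p bl bu B L pt) ∧
          ENNReal.ofReal (c * (n : ℝ) ^ (-(1 / 2) - (s : ℝ) / d)) ≤
            minimaxRisk d q n pt (shiftClassBallAt d s p bl bu B L pt) := by
  have hbu0 : 0 < bu := hbl.trans_le hbu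
  have hβ : 0 < B * bu := by positivity
  have hp0 : 0 < p := by linarith
  have hd' : (0 : ℝ) < d := by exact_mod_cast hd
  obtain ⟨ψ, K, hψ, hψs, hψQ, hψ0, hK, hKQ, hK1, hKv⟩ :=
    exists_bump d (δ := 1 / (2 * (B * bu))) (by positivity)
  obtain ⟨C, hC, hSob⟩ := exists_sobolev_bound d s hp hψ hψs hψQ
  set e₁ : ℝ := -(q : ℝ) * ((s : ℝ) / d - 1 / p) - 1 with he₁
  set e₂ : ℝ := -(1 / 2) - (s : ℝ) / d with he₂
  -- The sign of the exponents matters: `N ≤ R * n` gives a lower bound on `N ^ e` only for `e ≤ 0`.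
  -- Here `q ≤ p` enters.
  have he₁0 : e₁ ≤ 0 := by
    have h1 : (q : ℝ) * (1 / p) ≤ 1 := by rw [mul_one_div, div_le_one hp0]; exact hqp
    have h2 : 0 ≤ (q : ℝ) * ((s : ℝ) / d) := by positivity
    rw [he₁]; linarith
  have he₂0 : e₂ ≤ 0 := by
    have : 0 ≤ (s : ℝ) / d := by positivity
    rw [he₂]; linarith
  set J : ℝ := ((multiIndices d s).card : ℝ) with hJ
  have hJ0 : 0 < J := by
    rw [hJ]
    exact_mod_cast Finset.card_pos.2 ⟨0, by simp [multiIndices]⟩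
  -- The norm budget of a single derivative when there are `J` of them.
  set κ : ℝ := L / J with hκ
  have hκ0 : 0 < κ := by positivity
  have hJκ : J * κ = L := by rw [hκ]; field_simp
  set R : ℝ := 2 ^ d * (2 * bu) with hR
  have hR0 : 0 < R := by positivity
  set c₁ : ℝ := (κ / C) ^ q / 16 * R ^ e₁ with hc₁
  set c₂ : ℝ := κ / (2 * C) * (κ / 2) ^ (q - 1) / 16 * R ^ e₂ with hc₂
  have hc₁0 : 0 < c₁ := by positivity
  have hc₂0 : 0 < c₂ := by positivity
  refine ⟨min c₁ c₂, lt_min hc₁0 hc₂0, ?_⟩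
  rintro pt ⟨f, ps, h⟩ n hn
  have hps := h.2.1
  have hpt := h.2.2.1
  have hpsb : ∀ x ∈ cube d, ps x ≤ bu := fun x hx => (h.2.2.2.1 x hx).2
  obtain ⟨m, hm, hmn, hmR⟩ := exists_grid_size hd hn (one_le_of_density_le hps hpsb)
  have hm' : (1 : ℝ) ≤ m := by exact_mod_cast hm
  have hn' : (0 : ℝ) < n := by exact_mod_cast hn
  have hhalf := half_le_sum_core hpt hβ (target_le hbl hB h) hm hK hKQ hKv
  set N : ℝ := (m : ℝ) ^ d with hN
  have hN0 : 0 < N := by positivity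
  have hms : (m : ℝ) ^ s = N ^ ((s : ℝ) / d) := by
    rw [hN, ← Real.rpow_natCast _ d, ← Real.rpow_mul (by positivity),
      mul_div_cancel₀ _ hd'.ne', Real.rpow_natCast]
  have hrate : ∀ e : ℝ, e ≤ 0 → R ^ e * (n : ℝ) ^ e ≤ N ^ e := by
    intro e he
    rw [← Real.mul_rpow hR0.le hn'.le]
    exact Real.rpow_le_rpow_of_nonpos hN0 hmR he
  have hball : ∀ g : (Fin d → ℝ) → ℝ, MemSobolev d s p g →
      (∀ α ∈ multiIndices d s, weakDerivNorm p α g ≤ ENNReal.ofReal κ) →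
      (g, ps) ∈ shiftClassBallAt d s p bl bu B L pt := by
    intro g hg hgκ
    refine ⟨mem_shiftClassAt_of_memSobolev h hg, ?_⟩
    have := sobolevNorm_le_of_weakDerivNorm_le hp hgκ
    rwa [← hJ, hJκ] at this
  constructor
  -- The largest amplitude that the derivative bound allows: the cell volume `1 / N` contributes `N
  -- ^ (-1/p)` to the norm, so a single bump may be taller by `N ^ (1/p)`.
  · set A : ℝ := κ / C * N ^ (1 / p - (s : ℝ) / d) with hA
    have hA0 : 0 ≤ A := by positivity
    refine le_trans (ENNReal.ofReal_le_ofReal ?_) (minimaxRisk_ge_single hn hq hm hpt hps hbu0.le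
      hpsb hmn hψ hψs hψQ hψ0 hK hK1 hhalf hA0 fun k T => ?_)
    · calc min c₁ c₂ * (n : ℝ) ^ e₁ ≤ c₁ * (n : ℝ) ^ e₁ := by gcongr; exact min_le_left _ _
        _ = (κ / C) ^ q / 16 * (R ^ e₁ * (n : ℝ) ^ e₁) := by rw [hc₁]; ring
        _ ≤ (κ / C) ^ q / 16 * N ^ e₁ := by gcongr; exact hrate _ he₁0
        _ = A ^ q / (16 * N) := by
          have h1 : (N ^ (1 / p - (s : ℝ) / d)) ^ q = N ^ e₁ * N := by
            rw [← Real.rpow_natCast, ← Real.rpow_mul hN0.le, ← Real.rpow_add_one hN0.ne']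
            congr 1
            rw [he₁]; ring
          rw [hA, mul_pow, h1]
          field_simp
    · obtain ⟨h1, h2⟩ := hSob Unit 0 A m (fun _ => gridPoint k) T le_rfl hA0 hm'
        (pairwise_disjoint_cell_unit _ _)
      refine hball _ h1 fun α hα => (h2 α hα).trans (ENNReal.ofReal_le_ofReal (le_of_eq ?_))
      have h3 : N ^ (1 / p - (s : ℝ) / d) * N ^ ((s : ℝ) / d) * (1 / N) ^ (1 / p) = 1 := by
        rw [← Real.rpow_add hN0, sub_add_cancel, ← Real.mul_rpow hN0.le (by positivity),
          mul_one_div_cancel hN0.ne', Real.one_rpow]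
      rw [Fintype.card_unit, Nat.cast_one, hms, hA, zero_add]
      calc κ / C * N ^ (1 / p - (s : ℝ) / d) * N ^ ((s : ℝ) / d) * C * (1 / N) ^ (1 / p)
          = κ / C * C * (N ^ (1 / p - (s : ℝ) / d) * N ^ ((s : ℝ) / d) * (1 / N) ^ (1 / p)) := by
            ring
        _ = κ := by rw [h3, mul_one, div_mul_cancel₀ _ hC.ne']
  -- The bumps fill the cube, so there is no volume gain; half of the budget `κ` goes to the
  -- constant `M` and half to the bumps.
  · set A : ℝ := κ / (2 * C) * N ^ (-((s : ℝ) / d)) with hA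
    have hA0 : 0 ≤ A := by positivity
    refine le_trans (ENNReal.ofReal_le_ofReal ?_) (minimaxRisk_ge_all (M := κ / 2) hn hm hpt hps
      hbu0.le hpsb hmn hψ hψs hψQ hψ0 hK hK1 hhalf (by positivity) hA0 fun T => ?_)
    -- The first-order gain of the moment over the positive base `κ / 2`.
    · have hD : A * (κ / 2) ^ (q - 1) ≤ (κ / 2 + A) ^ q - (κ / 2) ^ q := by
        obtain ⟨r, rfl⟩ := Nat.exists_eq_succ_of_ne_zero hq
        have h1 : (κ / 2) ^ r ≤ (κ / 2 + A) ^ r := by gcongr; linarith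
        have h2 : (κ / 2 + A) * (κ / 2) ^ r ≤ (κ / 2 + A) * (κ / 2 + A) ^ r := by gcongr
        simp only [Nat.succ_eq_add_one, Nat.add_sub_cancel, pow_succ]
        linarith
      calc min c₁ c₂ * (n : ℝ) ^ e₂ ≤ c₂ * (n : ℝ) ^ e₂ := by gcongr; exact min_le_right _ _
        _ = κ / (2 * C) * (κ / 2) ^ (q - 1) / 16 * (R ^ e₂ * (n : ℝ) ^ e₂) := by rw [hc₂]; ring
        _ ≤ κ / (2 * C) * (κ / 2) ^ (q - 1) / 16 * N ^ e₂ := by gcongr; exact hrate _ he₂0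
        _ = A * (κ / 2) ^ (q - 1) / (16 * √N) := by
          have h1 : N ^ (-((s : ℝ) / d)) = N ^ e₂ * √N := by
            rw [Real.sqrt_eq_rpow, ← Real.rpow_add hN0]
            congr 1
            rw [he₂]; ring
          rw [hA, h1]
          field_simp
        _ ≤ _ := by gcongr
    · obtain ⟨h1, h2⟩ := hSob (Fin d → Fin m) (κ / 2) A m gridPoint T (by positivity) hA0 hm'
        pairwise_disjoint_cell
      refine hball _ h1 fun α hα => (h2 α hα).trans (ENNReal.ofReal_le_ofReal (le_of_eq ?_))
      have h3 : N ^ (-((s : ℝ) / d)) * N ^ ((s : ℝ) / d) = 1 := by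
        rw [← Real.rpow_add hN0, neg_add_cancel, Real.rpow_zero]
      rw [Fintype.card_fun, Fintype.card_fin, Fintype.card_fin, hms, hA]
      push_cast
      rw [← hN, div_self hN0.ne', Real.one_rpow]
      calc κ / 2 + κ / (2 * C) * N ^ (-((s : ℝ) / d)) * N ^ ((s : ℝ) / d) * C * 1
          = κ / 2 + κ / (2 * C) * C * (N ^ (-((s : ℝ) / d)) * N ^ ((s : ℝ) / d)) := by ring
        _ = κ := by rw [h3]; field_simp; norm_num

end CovShift

theorem theorem1 (d s q : ℕ) (p : ℝ) (hd : 0 < d) (hp : 2 ≤ p) (hqp : (q : ℝ) ≤ p)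
    (hpq : p ≤ 2 * q) :
    (∃ c : ℝ, 0 < c ∧ ∀ bl bu B : ℝ, 0 < bl → bl ≤ bu → 1 ≤ B →
      ∀ pt : (Fin d → ℝ) → ℝ, (∃ f ps, (f, ps, pt) ∈ CovShift.shiftClass d s p bl bu B) →
        ∀ n : ℕ, 0 < n →
          ENNReal.ofReal (c * (B * bu * (n : ℝ) ^ CovShift.rateExponent d s q p))
            ≤ CovShift.minimaxRisk d q n pt (CovShift.shiftClassAt d s p bl bu B pt)) ∧
    (∀ bl bu B L : ℝ, 0 < bl → bl ≤ bu → 1 ≤ B → 0 < L →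
      ∃ c : ℝ, 0 < c ∧
        ∀ pt : (Fin d → ℝ) → ℝ, (∃ f ps, (f, ps, pt) ∈ CovShift.shiftClass d s p bl bu B) →
          ∀ n : ℕ, 0 < n →
            ENNReal.ofReal (c * (B * bu * (n : ℝ) ^ CovShift.rateExponent d s q p))
              ≤ CovShift.minimaxRisk d q n pt
                  (CovShift.shiftClassBallAt d s p bl bu B L pt)) := by
  have hp1 : 1 ≤ p := by linarith
  have hq : q ≠ 0 := by
    rintro rfl
    norm_num at hpq
    linarith
  refine ⟨⟨1, one_pos, fun bl bu B hbl _ hB pt ⟨f, ps, h⟩ n hn => ?_⟩,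
    fun bl bu B L hbl hbu hB hL => ?_⟩
  · rw [CovShift.minimaxRisk_shiftClassAt_eq_top hd hp1 hq hbl hB h hn]
    exact le_top
  · have hbu0 : 0 < bu := hbl.trans_le hbu
    have hβ : 0 < B * bu := by positivity
    obtain ⟨c, hc, hrisk⟩ :=
      CovShift.exists_minimaxRisk_ball_ge (s := s) hd hp1 hq hqp hbl hbu hB hL
    -- In (b) the constant may depend on `B` and `bu`, so it absorbs the factor `B * bu`.
    refine ⟨c / (B * bu), by positivity, fun pt hpt n hn => ?_⟩
    obtain ⟨h1, h2⟩ := hrisk pt hpt n hn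
    rw [← mul_assoc, div_mul_cancel₀ _ hβ.ne', CovShift.rateExponent]
    rcases max_choice (-(q : ℝ) * ((s : ℝ) / d - 1 / p) - 1) (-(1 / 2) - (s : ℝ) / d)
      with hmax | hmax
    · rw [hmax]; exact h1
    · rw [hmax]; exact h2
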